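/- Let $U\subseteq\mathbb R^3$ be open and let $B$ be a nowhere zero, divergence-free $C^2$ vector field on $U$; put $b=B/|B|$, $c=\operatorname{curl} b$, $b^\flat=b\cdot dx$, and let $\Omega$ be the standard volume form. Write ${}'$ for the derivative by arc length along fieldlines, so $|B|'=b\cdot\nabla|B|$, and let $\Sigma=\{|B|'=0\}$. Fix a mass $m>0$ and a magnetic moment $\mu>0$. Zeroth-order guiding-centre (ZGC) dynamics on the phase space of pairs $(x,v_\parallel)\in U\times\mathbb R$ is $\dot x=v_\parallel b$, $\dot v_\parallel=-\frac{\mu}{m}|B|'$; it conserves $h=\frac1\mu\left(\frac12 m v_\parallel^2+\mu|B|\right)$. A (non-marginal) bouncing segment $\gamma$ of level $h$ is a piece of fieldline, parametrised by arc length $s\in[s_1,s_2]$, $s_1<s_2$, in the direction of $B$, with $|B|<h$ in its interior and $|B|=h$, $|B|'\neq0$ at both ends. Its action is $j=\int_{s_1}^{s_2}\sqrt{2(h-|B|)}\,ds$, its label is $M=\gamma\cap\Sigma$ (which determines the fieldline and the wells of $|B|$ that are visited), and the orbit that bounces in it consists of the points $(x,v_\parallel)$ with $x\in\gamma$ and scaled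 energy $h$. On the set of non-marginal bouncing phase points $w$, let $j(w)$ and $M(w)$ be the action and the label of the segment in which $w$ bounces. For a number $j$ and a label $M$ the reduced Hamiltonian $H_j(M)$ is the unique $h$ such that the segment with label $M$ and level $h$ has action $j$. Let $X$ be a $C^1$ vector field on an open subset $W$ of the phase space, whose flow commutes with that of ZGC dynamics and with $dj(X)=0$ at all bouncing points of $W$. Let $\gamma$ be a non-marginal bouncing segment with label $M$ and action $j$, whose bounce orbit is contained in $W$. Then the level of $\gamma$ is $H_j(M)$, and at every point $z$ of the bounce orbit, where $M(z)=M$, the function $w\mapsto H_j(M(w))$ ($j$ fixed) is differentiable, and its derivative in the direction $X(z)$ is $$i_XdH_j=\frac1{T_s}\int_\gamma\left(\frac{X_\perp\cdot\nabla|B|}{\sqrt{2(H_j-|B|)}}\,b^\flat-\sqrt{2(H_j-|B|)}\;i_Xi_c\Omega\right),\qquad T_s=\int_\gamma\frac{b^\flat}{\sqrt{2(H_j-|B|)}},$$ where $i_Xi_c\Omega=\Omega(c,X,\cdot)$, $X$ in the integrand means the spatial part of $X$ at the points of either one of the two branches $v_\parallel=\pm\sqrt{\frac2m(\mu H_j-\mu|B|)}$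 of the bounce orbit over $\gamma$, and $X_\perp$ is the component of this spatial part perpendicular to $b$. Both integrals converge absolutely, $T_s>0$, and $T_s=\sqrt{\mu/m}\;T/2$, where $T=2\int_{s_1}^{s_2}ds/|v_\parallel|$ is the true bounce period. -/

import Mathlib

open Set Filter Topology MeasureTheory

noncomputable section

namespace GuidingCentre

/-- Physical space `ℝ³`. -/
abbrev Space : Type := EuclideanSpace ℝ (Fin 3)

/-- Guiding-centre phase space: pairs (position, parallel velocity). -/
abbrev Phase : Type := Space × ℝ

/-! ### Vector calculus in `ℝ³` -/

/-- The partial derivative `∂ᵢ Fₖ` at `x`. -/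
def partialD (F : Space → Space) (x : Space) (i k : Fin 3) : ℝ :=
  fderiv ℝ F x (EuclideanSpace.single i 1) k

/-- The divergence of a vector field. -/
def divergence (F : Space → Space) (x : Space) : ℝ :=
  ∑ i, partialD F x i i

/-- The curl of a vector field. -/
def curl (F : Space → Space) (x : Space) : Space :=
  !₂[partialD F x 1 2 - partialD F x 2 1,
     partialD F x 2 0 - partialD F x 0 2,
     partialD F x 0 1 - partialD F x 1 0]

/-- The standard volume form `Ω` of `ℝ³`. -/
def vol (u v w : Space) : ℝ :=
  Matrix.det (Matrix.of ![u.ofLp, v.ofLp, w.ofLp])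

/-! ### The magnetic field -/

/-- A nowhere zero, divergence-free `C²` magnetic field on an open domain `U` of `ℝ³`. -/
structure IsMagneticField (U : Set Space) (B : Space → Space) : Prop where
  isOpen : IsOpen U
  contDiffOn : ContDiffOn ℝ 2 B U
  ne_zero : ∀ x ∈ U, B x ≠ 0
  div_eq_zero : ∀ x ∈ U, divergence B x = 0

/-- The unit field `b = B / |B|`. -/
def unitField (B : Space → Space) (x : Space) : Space := ‖B x‖⁻¹ • B x

/-- The gradient `∇|B|` of the field strength. -/
def gradStrength (B : Space → Space) (x : Space) : Space :=
  gradient (fun y => ‖B y‖) x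

/-- The derivative `|B|' = b · ∇|B|` of the field strength by arc length along the fieldline. -/
def strengthDeriv (B : Space → Space) (x : Space) : ℝ :=
  inner ℝ (unitField B x) (gradStrength B x)

/-- The component `u_⊥ = u - (u · b) b` of a vector `u` at `x` perpendicular to the field. -/
def perp (B : Space → Space) (x u : Space) : Space :=
  u - inner ℝ u (unitField B x) • unitField B x

/-- The set `Σ` of critical points of `|B|` along fieldlines. -/
def criticalSet (U : Set Space) (B : Space → Space) : Set Space :=
  {x ∈ U | strengthDeriv B x = 0}

/-! ### Zeroth-order guiding-centre dynamics -/

/-- The vector field of zeroth-order guiding-centre motion: `ẋ = v b`, `v̇ = -(μ/m) |B|'`. -/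
def zgcField (m μ : ℝ) (B : Space → Space) (z : Phase) : Phase :=
  (z.2 • unitField B z.1, -(μ / m) * strengthDeriv B z.1)

/-- The scaled energy `h = E / μ`, where `E = m v² / 2 + μ |B|`. -/
def scaledEnergy (m μ : ℝ) (B : Space → Space) (z : Phase) : ℝ :=
  (m * z.2 ^ 2 / 2 + μ * ‖B z.1‖) / μ

/-- `φ` is a flow of the vector field `X` for times in `(-ε, ε)`, started from points of `N`
and staying in `W`. -/
def IsLocalFlow (X : Phase → Phase) (W : Set Phase) (φ : ℝ → Phase → Phase) (N : Set Phase)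
    (ε : ℝ) : Prop :=
  ∀ w ∈ N, φ 0 w = w ∧
    ∀ t ∈ Ioo (-ε) ε, φ t w ∈ W ∧ HasDerivAt (fun t' => φ t' w) (X (φ t w)) t

/-- The (local) flows of the vector fields `X` and `Y` on the open set `W` commute. -/
def FlowsCommuteOn (X Y : Phase → Phase) (W : Set Phase) : Prop :=
  ∀ z ∈ W, ∃ ε > 0, ∃ N ∈ 𝓝 z, ∃ φ ψ : ℝ → Phase → Phase,
    IsLocalFlow X W φ N ε ∧ IsLocalFlow Y W ψ N ε ∧
    ∀ s ∈ Ioo (-ε) ε, ∀ t ∈ Ioo (-ε) ε,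
      φ s z ∈ N ∧ ψ t z ∈ N ∧ φ s (ψ t z) = ψ t (φ s z)

/-! ### Bouncing segments -/

/-- A non-marginal bouncing segment: a piece of fieldline, parametrised by arc length `s` in
`[left, right]` in the direction of `B`, with `|B| < level` inside, and with `|B| = level` and
`|B|' ≠ 0` at both ends. -/
structure Segment (U : Set Space) (B : Space → Space) where
  curve : ℝ → Space
  left : ℝ
  right : ℝ
  level : ℝ
  left_lt_right : left < right
  mem_domain : ∀ s ∈ Icc left right, curve s ∈ U
  tangent : ∀ s ∈ Icc left right,
    HasDerivWithinAt curve (unitField B (curve s)) (Icc left right) s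
  strength_lt : ∀ s ∈ Ioo left right, ‖B (curve s)‖ < level
  strength_left : ‖B (curve left)‖ = level
  strength_right : ‖B (curve right)‖ = level
  turning_left : strengthDeriv B (curve left) ≠ 0
  turning_right : strengthDeriv B (curve right) ≠ 0

namespace Segment

variable {U : Set Space} {B : Space → Space}

/-- The function `√(2 (h - |B|))` along the segment, `h` being the level of its ends. -/
def speed (γ : Segment U B) (s : ℝ) : ℝ := √(2 * (γ.level - ‖B (γ.curve s)‖))

/-- The action `∫ √(2 (h - |B|)) ds` of the segment. -/
def action (γ : Segment U B) : ℝ := ∫ s in γ.left..γ.right, γ.speed s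

/-- The set of intersections of the segment with `Σ`. As it is nonempty, it also specifies
the fieldline. -/
def wells (γ : Segment U B) : Set Space :=
  γ.curve '' Icc γ.left γ.right ∩ criticalSet U B

/-- The value of a 1-form along the segment on the tangent vector of the segment. A 1-form along
the segment is given by its value `α s w` on vectors `w` at the point of arc length `s`. -/
def onTangent (γ : Segment U B) (α : ℝ → Space → ℝ) (s : ℝ) : ℝ :=
  α s (unitField B (γ.curve s))

/-- The integral over the segment of a 1-form along it. -/
def integral (γ : Segment U B) (α : ℝ → Space → ℝ) : ℝ :=
  ∫ s in γ.left..γ.right, γ.onTangent α s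

/-- The 1-form `b^♭ / √(2 (h - |B|))` along the segment. -/
def timeForm (γ : Segment U B) : ℝ → Space → ℝ := fun s w =>
  1 / γ.speed s * inner ℝ (unitField B (γ.curve s)) w

/-- The scaled time `T_s = ∫ b^♭ / √(2 (h - |B|))`. -/
def scaledTime (γ : Segment U B) : ℝ := γ.integral γ.timeForm

/-- The magnitude of the parallel velocity, `√((2/m) (E - μ |B|))` with `E = μ h`, of the
zeroth-order motion bouncing in the segment. -/
def parallelSpeed (m μ : ℝ) (γ : Segment U B) (s : ℝ) : ℝ :=
  √(2 / m * (μ * γ.level - μ * ‖B (γ.curve s)‖))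

/-- The true bounce period `T = 2 ∫ ds / v`. -/
def bouncePeriod (m μ : ℝ) (γ : Segment U B) : ℝ :=
  2 * ∫ s in γ.left..γ.right, (γ.parallelSpeed m μ s)⁻¹

/-- The phase point `z` lies on the zeroth-order orbit that bounces in the segment `γ`. -/
def Carries (m μ : ℝ) (γ : Segment U B) (z : Phase) : Prop :=
  z.1 ∈ γ.curve '' Icc γ.left γ.right ∧ scaledEnergy m μ B z = γ.level

/-- For a vector field `X` on phase space, the 1-form
`(X_⊥ · ∇|B|) / √(2 (h - |B|)) b^♭ - √(2 (h - |B|)) i_X i_c Ω`, with `c = curl b`, along the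
segment. Here `X` is evaluated on the branch of sign `σ` of the bounce orbit over the segment,
and only the spatial part of `X` enters. -/
def derivForm (m μ : ℝ) (γ : Segment U B) (X : Phase → Phase) (σ : ℝ) : ℝ → Space → ℝ :=
  fun s w =>
    let x := γ.curve s
    let u := (X (x, σ * γ.parallelSpeed m μ s)).1
    inner ℝ (perp B x u) (gradStrength B x) / γ.speed s * inner ℝ (unitField B x) w
      - γ.speed s * vol (curl (unitField B) x) u w

end Segment

/-- The phase point `z` belongs to a non-marginal bouncing orbit. -/
def IsBouncing (m μ : ℝ) (U : Set Space) (B : Space → Space) (z : Phase) : Prop :=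
  ∃ γ : Segment U B, γ.Carries m μ z

open Classical in
/-- The function `j` on the non-marginal bouncing part of phase space: the action of the segment
in which `z` bounces (the value elsewhere is irrelevant). -/
def actionAt (m μ : ℝ) (U : Set Space) (B : Space → Space) (z : Phase) : ℝ :=
  if hz : IsBouncing m μ U B z then hz.choose.action else 0

open Classical in
/-- The label `M` of a phase point in the non-marginal bouncing part of phase space: the set of
intersections with `Σ` of the segment in which `z` bounces (the value elsewhere is irrelevant). -/
def wellsAt (m μ : ℝ) (U : Set Space) (B : Space → Space) (z : Phase) : Set Space :=
  if hz : IsBouncing m μ U B z then hz.choose.wells else ∅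

/-- The reduced Hamiltonian `H_j(M)`: the value `h` for which the segment labelled by `M` with
`|B| = h` at its ends has action `j`. -/
def reducedHamiltonian (U : Set Space) (B : Space → Space) (j : ℝ) (M : Set Space) : ℝ :=
  Classical.epsilon fun h : ℝ =>
    ∃ γ : Segment U B, γ.wells = M ∧ γ.level = h ∧ γ.action = j

end GuidingCentre

end

open GuidingCentre

/-! Near the given segment, fieldlines are parametrised by the point `x` where they pass at a fixed
arc length `s₀`. On an arc-length window slightly longer than the segment, put `J(x, h) = ∫ √(2 (h -
|B|)) ds` (`familyAction`). Since `√` vanishes on negative numbers, the window can stay fixed while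
the turning points move, and `J(x, h)` is the action of the nearby segment of level `h`. Its label
is the set of critical points on the middle part of the fieldline, so it depends on `x` alone; hence
`w ↦ H_j(M(w))` is locally a function of position, defined implicitly by `J(x, H) = j`.

The turning points are transversal, so `|h - |B||` grows linearly away from them and its inverse
root is integrable. Dominated convergence (`hasFDerivAt_integral_sqrt`) then differentiates `J` at
the central segment: the derivative is `T_s` in the level and `-∫ ∇|B| · Y / √(2 (h - |B|)) ds` in
the direction `Y(s₀)`, where `Y` solves the variation equation `Y' = Db Y`. Differentiability is
available at this one point only, so the implicit function is treated by hand: existence by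
intermediate values (`eventually_exists_level`), uniqueness by strict monotonicity of the action in
the level (`action_lt_action`), and the derivative by `hasFDerivAt_of_implicit`. The result is
`dH_j(X) = T_s⁻¹ ∫ ∇|B| · Y / √(2 (h - |B|)) ds`, where `Y(s₀)` is the spatial part of `X(z)`.

Commuting flows have zero Lie bracket. Along a branch of the bounce orbit, parametrised by arc
length, the spatial part of `X` therefore solves the variation equation up to multiples of `b`, so
its perpendicular part stays equal to that of `Y`. The branches meet where `v_∥ = 0`, which carries
the equality from the branch of `z` to the other (`perp_eq_of_commute`).

Finally `Ω(c, X, b) = -X · (b·∇b)`, which sees only `X_⊥`. The stated integrand then differs from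
`∇|B| · Y / √(2 (h - |B|))` by the arc-length derivative of `√(2 (h - |B|)) (Y · b)`, which vanishes
at both ends (`integral_variation_eq`). -/

namespace GuidingCentre

/-! ### Grönwall estimates, flows and their linearisation -/

section ODE

open scoped NNReal

variable {E F : Type*} [NormedAddCommGroup E] [NormedSpace ℝ E]
  [NormedAddCommGroup F] [NormedSpace ℝ F]

/-- Grönwall's inequality on one side of the initial time, with an explicit bound. -/
theorem norm_le_exp_of_norm_deriv_le_right {f f' : ℝ → E} {K ε a b : ℝ} (hK : 0 < K)
    (hε : 0 ≤ ε) (hf : ∀ t ∈ Icc a b, HasDerivWithinAt f (f' t) (Icc a b) t)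
    (hb : ∀ t ∈ Icc a b, ‖f' t‖ ≤ K * ‖f t‖ + ε) :
    ∀ t ∈ Icc a b, ‖f t‖ ≤ (‖f a‖ + ε / K) * Real.exp (K * (b - a)) := by
  intro t ht
  have h := norm_le_gronwallBound_of_norm_deriv_right_le (f := f) (f' := f') (δ := ‖f a‖)
    (K := K) (ε := ε) (a := a) (b := b) (fun t ht => (hf t ht).continuousWithinAt)
    (fun x hx => (hf x ⟨hx.1, hx.2.le⟩).mono_of_mem_nhdsWithin (Icc_mem_nhdsGE_of_mem hx)) le_rfl
    (fun x hx => hb x ⟨hx.1, hx.2.le⟩) t ht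
  refine h.trans ((gronwallBound_mono (norm_nonneg _) hε hK.le
    (sub_le_sub_right ht.2 a)).trans ?_)
  rw [gronwallBound_of_K_ne_0 hK.ne']
  have : 0 ≤ ε / K := by positivity
  simp only
  nlinarith

/-- Grönwall's inequality on both sides of the initial time `t₀`. -/
theorem norm_le_exp_of_norm_deriv_le {f f' : ℝ → E} {K ε a b t₀ : ℝ} (hK : 0 < K)
    (hε : 0 ≤ ε) (ht₀ : t₀ ∈ Icc a b)
    (hf : ∀ t ∈ Icc a b, HasDerivWithinAt f (f' t) (Icc a b) t)
    (hb : ∀ t ∈ Icc a b, ‖f' t‖ ≤ K * ‖f t‖ + ε) :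
    ∀ t ∈ Icc a b, ‖f t‖ ≤ (‖f t₀‖ + ε / K) * Real.exp (K * (b - a)) := by
  intro t ht
  have hc : 0 ≤ ‖f t₀‖ + ε / K := by positivity
  rcases le_total t₀ t with h | h
  · have hsub : Icc t₀ b ⊆ Icc a b := Icc_subset_Icc_left ht₀.1
    refine (norm_le_exp_of_norm_deriv_le_right hK hε
      (fun s hs => (hf s (hsub hs)).mono hsub) (fun s hs => hb s (hsub hs)) t ⟨h, ht.2⟩).trans ?_
    have := ht₀.1
    gcongr
  -- Times before `t₀` are handled by reversing time.
  · have hmap : MapsTo (fun s : ℝ => -s) (Icc (-t₀) (-a)) (Icc a b) := fun s hs =>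
      ⟨by linarith [hs.2], by linarith [hs.1, ht₀.2]⟩
    have key := norm_le_exp_of_norm_deriv_le_right (f := fun s => f (-s))
      (f' := fun s => -f' (-s)) (a := -t₀) (b := -a) hK hε
      (fun s hs => by
        simpa [Function.comp_def] using (hf (-s) (hmap hs)).scomp s
          ((hasDerivAt_neg s).hasDerivWithinAt) hmap)
      (fun s hs => by simpa using hb (-s) (hmap hs)) (-t) ⟨by linarith, by linarith [ht.1]⟩
    simp only [neg_neg] at key
    refine key.trans ?_
    have : -a - -t₀ ≤ b - a := by linarith [ht₀.2]
    gcongr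

theorem eq_zero_of_norm_deriv_le {f f' : ℝ → E} {K a b t₀ : ℝ} (hK : 0 < K)
    (ht₀ : t₀ ∈ Icc a b) (h₀ : f t₀ = 0)
    (hf : ∀ t ∈ Icc a b, HasDerivWithinAt f (f' t) (Icc a b) t)
    (hb : ∀ t ∈ Icc a b, ‖f' t‖ ≤ K * ‖f t‖) :
    ∀ t ∈ Icc a b, f t = 0 := by
  intro t ht
  have := norm_le_exp_of_norm_deriv_le hK le_rfl ht₀ hf (by simpa using hb) t ht
  simpa [h₀] using this

/-- A bounded vector field, Lipschitz in space and continuous in time, has integral curves on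
arbitrary time intervals. -/
theorem exists_integralCurve_of_bounded [CompleteSpace E] {v : ℝ → E → E} {K L : ℝ≥0}
    {a b t₀ : ℝ} (ht₀ : t₀ ∈ Icc a b) (hK : ∀ t ∈ Icc a b, LipschitzWith K (v t))
    (hc : ∀ x, ContinuousOn (fun t => v t x) (Icc a b))
    (hL : ∀ t ∈ Icc a b, ∀ x, ‖v t x‖ ≤ L) (x : E) :
    ∃ α : ℝ → E, α t₀ = x ∧
      ∀ t ∈ Icc a b, HasDerivWithinAt α (v t (α t)) (Icc a b) t := by
  have hm : 0 ≤ max (b - t₀) (t₀ - a) := le_max_of_le_left (by linarith [ht₀.2])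
  -- The radius is the speed bound times the longest time available, so no solution can leave the
  -- ball.
  have hpl : IsPicardLindelof v (⟨t₀, ht₀⟩ : Icc a b) x
      (L * .mk (max (b - t₀) (t₀ - a)) hm) 0 L K :=
    { lipschitzOnWith := fun t ht => (hK t ht).lipschitzOnWith
      continuousOn := fun x _ => hc x
      norm_le := fun t ht x _ => hL t ht x
      mul_max_le := by simp }
  exact hpl.exists_eq_forall_mem_Icc_hasDerivWithinAt₀

/-- In finite dimensions the identity can be truncated to a bounded Lipschitz map that does not
increase norms. -/
theorem exists_truncation [FiniteDimensional ℝ E] (R : ℝ) :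
    ∃ (T : E → E) (K L : ℝ≥0), LipschitzWith K T ∧ (∀ x, ‖T x‖ ≤ L) ∧ (∀ x, ‖T x‖ ≤ ‖x‖) ∧
      ∀ x, ‖x‖ ≤ R → T x = x := by
  have hR : 0 < max R 1 := by positivity
  let χ : ContDiffBump (0 : E) := ⟨max R 1, max R 1 + 1, hR, by linarith⟩
  have hsmooth : ContDiff ℝ 1 fun x => χ x • x := χ.contDiff.smul contDiff_id
  have hsupp : HasCompactSupport fun x => χ x • x := χ.hasCompactSupport.smul_right
  obtain ⟨K, hK⟩ := ContDiff.lipschitzWith_of_hasCompactSupport hsupp hsmooth one_ne_zero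
  obtain ⟨L, hL⟩ := hsupp.exists_bound_of_continuous hsmooth.continuous
  refine ⟨_, K, L.toNNReal, hK, fun x => (hL x).trans (Real.le_coe_toNNReal L), fun x => ?_,
    fun x hx => ?_⟩
  · rw [norm_smul, Real.norm_of_nonneg χ.nonneg]
    exact mul_le_of_le_one_left (norm_nonneg _) χ.le_one
  · have : χ x = 1 := χ.one_of_mem_closedBall 
      (mem_closedBall_zero_iff.2 (hx.trans (le_max_left R 1)))
    simp [this]

/-- The fundamental solution of a linear differential equation. -/
theorem exists_fundamental_solution [FiniteDimensional ℝ E] {A : ℝ → E →L[ℝ] E}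
    {a b t₀ : ℝ} (ht₀ : t₀ ∈ Icc a b) (hA : ContinuousOn A (Icc a b)) :
    ∃ D : ℝ → E →L[ℝ] E, D t₀ = ContinuousLinearMap.id ℝ E ∧
      ∀ t ∈ Icc a b, HasDerivWithinAt D ((A t).comp (D t)) (Icc a b) t := by
  obtain ⟨M, hM⟩ := isCompact_Icc.exists_bound_of_continuousOn hA
  set K : ℝ≥0 := .mk (max M 1) (by positivity) with hKdef
  have hK : (0 : ℝ) < K := lt_of_lt_of_le one_pos (le_max_right M 1)
  have hAK : ∀ t ∈ Icc a b, ‖A t‖ ≤ K := fun t ht => (hM t ht).trans (le_max_left _ _)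
  -- The truncation radius is the Grönwall bound of the linear equation. As `T` does not increase
  -- norms, the truncated equation obeys the same bound, so the truncation is never active on its
  -- solution.
  obtain ⟨T, K', L, hT, hTL, hTle, hTid⟩ := exists_truncation (E := E →L[ℝ] E)
    (‖ContinuousLinearMap.id ℝ E‖ * Real.exp (K * (b - a)))
  have : CompleteSpace E := FiniteDimensional.complete ℝ E
  obtain ⟨D, hD₀, hD⟩ := exists_integralCurve_of_bounded (v := fun t Φ => (A t).comp (T Φ))
    (K := K * K') (L := K * L) ht₀
    (fun t ht => LipschitzWith.of_dist_le_mul fun Φ Ψ => by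
      rw [dist_eq_norm, ← ContinuousLinearMap.comp_sub]
      refine (ContinuousLinearMap.opNorm_comp_le _ _).trans ?_
      rw [NNReal.coe_mul, mul_assoc, ← dist_eq_norm]
      exact mul_le_mul (hAK t ht) (hT.dist_le_mul _ _) dist_nonneg K.2)
    (fun Φ => hA.clm_comp continuousOn_const)
    (fun t ht Φ => (ContinuousLinearMap.opNorm_comp_le _ _).trans
      (mul_le_mul (hAK t ht) (hTL Φ) (norm_nonneg _) K.2))
    (ContinuousLinearMap.id ℝ E)
  have hbound := norm_le_exp_of_norm_deriv_le hK le_rfl ht₀ hD (fun t ht => by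
    rw [add_zero]
    exact (ContinuousLinearMap.opNorm_comp_le _ _).trans
      (mul_le_mul (hAK t ht) (hTle _) (norm_nonneg _) K.2))
  refine ⟨D, hD₀, fun t ht => ?_⟩
  have := hD t ht
  rwa [hTid (D t) (by simpa [hD₀] using hbound t ht)] at this

/-- A `C¹` map near a compact set agrees there with a compactly supported `C¹` map. -/
theorem exists_compactlySupported_eqOn [FiniteDimensional ℝ E] {G : E → F} {U S : Set E}
    (hU : IsOpen U) (hG : ContDiffOn ℝ 1 G U) (hS : IsCompact S) (hSU : S ⊆ U) :
    ∃ v : E → F, ContDiff ℝ 1 v ∧ HasCompactSupport v ∧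
      ∃ V, IsOpen V ∧ S ⊆ V ∧ V ⊆ U ∧ EqOn v G V := by
  obtain ⟨L, hL, hSL, hLU⟩ := exists_compact_between hS hU hSU
  obtain ⟨χ, hχ, hχ0, -⟩ := exists_contMDiffMap_one_nhds_of_subset_interior (n := 1)
    (modelWithCornersSelf ℝ E) hS.isClosed hSL
  have hχd : ContDiff ℝ 1 χ := χ.contMDiff.contDiff
  obtain ⟨V, hV, hSV, hVχ⟩ := eventually_nhdsSet_iff_exists.1 hχ
  refine ⟨fun x => χ x • G x, contDiff_iff_contDiffAt.2 fun x => ?_,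
    HasCompactSupport.intro hL fun x hx => by simp [hχ0 x hx],
    V ∩ U, hV.inter hU, subset_inter hSV hSU, inter_subset_right,
    fun x hx => by simp [hVχ x hx.1]⟩
  by_cases hx : x ∈ U
  · exact hχd.contDiffAt.smul (hG.contDiffAt (hU.mem_nhds hx))
  · refine (contDiffAt_const (c := (0 : F))).congr_of_eventuallyEq ?_
    filter_upwards [hL.isClosed.isOpen_compl.mem_nhds fun h => hx (hLU h)] with y hy
    simp [hχ0 y hy]

/-- The flow of a compactly supported `C¹` vector field is Lipschitz and differentiable in the
initial condition, and its derivative solves the linearised equation. -/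
theorem exists_flow [FiniteDimensional ℝ E] {v : E → E} (hv : ContDiff ℝ 1 v)
    (hvc : HasCompactSupport v) {a b t₀ : ℝ} (ht₀ : t₀ ∈ Icc a b) :
    ∃ (α : E → ℝ → E) (C : ℝ), 0 < C ∧ (∀ x, α x t₀ = x) ∧
      (∀ x, ∀ t ∈ Icc a b, HasDerivWithinAt (α x) (v (α x t)) (Icc a b) t) ∧
      (∀ x y, ∀ t ∈ Icc a b, ‖α x t - α y t‖ ≤ C * ‖x - y‖) ∧
      ∀ x₀, ∃ D : ℝ → E →L[ℝ] E, D t₀ = ContinuousLinearMap.id ℝ E ∧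
        (∀ t ∈ Icc a b, HasDerivWithinAt D ((fderiv ℝ v (α x₀ t)).comp (D t)) (Icc a b) t) ∧
        ∀ t ∈ Icc a b, HasFDerivAt (fun x => α x t) (D t) x₀ := by
  have : CompleteSpace E := FiniteDimensional.complete ℝ E
  obtain ⟨K₀, hK₀⟩ := ContDiff.lipschitzWith_of_hasCompactSupport hvc hv one_ne_zero
  obtain ⟨L, hL⟩ := hvc.exists_bound_of_continuous hv.continuous
  have hvK : LipschitzWith (max K₀ 1) v := hK₀.weaken (le_max_left _ _)
  set K : ℝ≥0 := max K₀ 1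
  have hK : (0 : ℝ) < K := lt_of_lt_of_le one_pos (by exact_mod_cast le_max_right K₀ 1)
  choose α hα₀ hα using fun x => exists_integralCurve_of_bounded (v := fun _ => v)
    (L := L.toNNReal) ht₀ (fun t _ => hvK) (fun _ => continuousOn_const)
    (fun t _ y => (hL y).trans (Real.le_coe_toNNReal L)) x
  have hexp := Real.exp_pos (K * (b - a))
  have hlip : ∀ x y, ∀ t ∈ Icc a b, ‖α x t - α y t‖ ≤ Real.exp (K * (b - a)) * ‖x - y‖ := by
    intro x y t ht
    have := norm_le_exp_of_norm_deriv_le (f := fun t => α x t - α y t) hK le_rfl ht₀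
      (fun t ht => (hα x t ht).sub (hα y t ht))
      (fun t ht => by simpa using hvK.norm_sub_le (α x t) (α y t)) t ht
    simpa [hα₀, mul_comm] using this
  refine ⟨α, _, hexp, hα₀, hα, hlip, fun x₀ => ?_⟩
  have hcα : ContinuousOn (α x₀) (Icc a b) := fun t ht => (hα x₀ t ht).continuousWithinAt
  have hDv : Continuous (fderiv ℝ v) := hv.continuous_fderiv one_ne_zero
  obtain ⟨D, hD₀, hD⟩ := exists_fundamental_solution ht₀ (hDv.comp_continuousOn hcα)
  refine ⟨D, hD₀, hD, fun t ht => ?_⟩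
  rw [hasFDerivAt_iff_isLittleO, Asymptotics.isLittleO_iff]
  intro ε hε
  -- One exponential cancels the Lipschitz constant of the flow, the other and `K` cancel the
  -- Grönwall factor, leaving exactly `ε`.
  set ε' : ℝ := ε * K / Real.exp (K * (b - a)) / Real.exp (K * (b - a)) with hε'def
  have hε' : 0 < ε' := by positivity
  have hunif : UniformContinuous (fderiv ℝ v) :=
    hDv.uniformContinuous_of_tendsto_cocompact
      (hvc.fderiv ℝ).is_zero_at_infty
  obtain ⟨δ, hδ, hδv⟩ := Metric.uniformContinuous_iff.1 hunif ε' hε'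
  have hball : ∀ᶠ x in 𝓝 x₀, Real.exp (K * (b - a)) * ‖x - x₀‖ < δ := by
    have : Tendsto (fun x => Real.exp (K * (b - a)) * ‖x - x₀‖) (𝓝 x₀) (𝓝 0) := by
      have h : Continuous fun x => Real.exp (K * (b - a)) * ‖x - x₀‖ := by fun_prop
      simpa using h.tendsto x₀
    exact this.eventually_lt_const hδ
  filter_upwards [hball] with x hx
  -- The error of the linear approximation solves the linearised equation up to the Taylor remainder
  -- of `v`, and starts from zero.
  have key := norm_le_exp_of_norm_deriv_le (f := fun s => α x s - α x₀ s - D s (x - x₀))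
    (f' := fun s => v (α x s) - v (α x₀ s) - (fderiv ℝ v (α x₀ s)) (D s (x - x₀)))
    (ε := ε' * (Real.exp (K * (b - a)) * ‖x - x₀‖)) hK (by positivity) ht₀
    (fun s hs => ((hα x s hs).sub (hα x₀ s hs)).sub (by
      simpa using (hD s hs).clm_apply (hasDerivWithinAt_const s (Icc a b) (x - x₀))))
    (fun s hs => by
      have h1 : ‖v (α x s) - v (α x₀ s) - (fderiv ℝ v (α x₀ s)) (α x s - α x₀ s)‖
          ≤ ε' * ‖α x s - α x₀ s‖ := by
        refine (convex_ball (α x₀ s) δ).norm_image_sub_le_of_norm_fderiv_le'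
          (fun y _ => (hv.differentiable one_ne_zero) y) (fun y hy => ?_)
          (Metric.mem_ball_self hδ) ?_
        · rw [← dist_eq_norm]
          exact (hδv hy).le
        · rw [Metric.mem_ball, dist_eq_norm]
          exact (hlip x x₀ s hs).trans_lt hx
      have h2 : ‖(fderiv ℝ v (α x₀ s)) (α x s - α x₀ s - D s (x - x₀))‖
          ≤ K * ‖α x s - α x₀ s - D s (x - x₀)‖ :=
        ((fderiv ℝ v (α x₀ s)).le_opNorm _).trans
          (mul_le_mul_of_nonneg_right (norm_fderiv_le_of_lipschitz ℝ hvK) (norm_nonneg _))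
      have h3 : v (α x s) - v (α x₀ s) - (fderiv ℝ v (α x₀ s)) (D s (x - x₀))
          = (fderiv ℝ v (α x₀ s)) (α x s - α x₀ s - D s (x - x₀))
            + (v (α x s) - v (α x₀ s) - (fderiv ℝ v (α x₀ s)) (α x s - α x₀ s)) := by
        rw [map_sub _ (α x s - α x₀ s)]
        abel
      rw [h3]
      refine (norm_add_le _ _).trans (add_le_add h2 (h1.trans ?_))
      exact mul_le_mul_of_nonneg_left (hlip x x₀ s hs) hε'.le) t ht
  refine key.trans (le_of_eq ?_)
  simp only [hα₀, hD₀, ContinuousLinearMap.id_apply, sub_self, norm_zero, zero_add, hε'def]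
  field_simp

end ODE

/-! ### Differential identities for the unit field and the field strength -/

section Field

/-- The curl is the antisymmetric part of the derivative, so `curl F · (u × w) = w · DF u - u · DF
w`; here `w = F x`. -/
theorem vol_curl_eq (F : Space → Space) (x u : Space) :
    vol (curl F x) u (F x) = inner ℝ (fderiv ℝ F x u) (F x) - inner ℝ u (fderiv ℝ F x (F x)) := by
  have h : ∀ w : Space, fderiv ℝ F x w = ∑ i, w i • fderiv ℝ F x (EuclideanSpace.single i 1) := by
    intro w
    conv_lhs => rw [← (EuclideanSpace.basisFun (Fin 3) ℝ).sum_repr w]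
    simp
  rw [h u, h (F x)]
  simp only [vol, curl, partialD, Matrix.det_fin_three, PiLp.inner_apply, Fin.sum_univ_three]
  simp
  ring

namespace IsMagneticField

variable {U : Set Space} {B : Space → Space} {x : Space}

theorem contDiffAt (hB : IsMagneticField U B) (hx : x ∈ U) : ContDiffAt ℝ 2 B x :=
  hB.contDiffOn.contDiffAt (hB.isOpen.mem_nhds hx)

theorem contDiffAt_strength (hB : IsMagneticField U B) (hx : x ∈ U) :
    ContDiffAt ℝ 2 (fun y => ‖B y‖) x :=
  (hB.contDiffAt hx).norm ℝ (hB.ne_zero x hx)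

theorem contDiffAt_unitField (hB : IsMagneticField U B) (hx : x ∈ U) :
    ContDiffAt ℝ 2 (unitField B) x :=
  ((hB.contDiffAt_strength hx).inv (norm_ne_zero_iff.2 (hB.ne_zero x hx))).smul (hB.contDiffAt hx)

theorem contDiffAt_gradStrength (hB : IsMagneticField U B) (hx : x ∈ U) :
    ContDiffAt ℝ 1 (gradStrength B) x :=
  (InnerProductSpace.toDual ℝ Space).symm.toContinuousLinearEquiv.contDiff.contDiffAt.comp x
    ((hB.contDiffAt_strength hx).fderiv_right (m := 1) (by norm_num))

theorem contDiffAt_strengthDeriv (hB : IsMagneticField U B) (hx : x ∈ U) :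
    ContDiffAt ℝ 1 (strengthDeriv B) x :=
  ((hB.contDiffAt_unitField hx).of_le (by norm_num)).inner ℝ (hB.contDiffAt_gradStrength hx)

theorem continuousAt_strength (hB : IsMagneticField U B) (hx : x ∈ U) :
    ContinuousAt (fun y => ‖B y‖) x := (hB.contDiffAt_strength hx).continuousAt

theorem contDiffAt_zgcField (hB : IsMagneticField U B) (m μ : ℝ) {z : Phase} (hz : z.1 ∈ U) :
    ContDiffAt ℝ 1 (zgcField m μ B) z := by
  have h1 : ContDiffAt ℝ 1 (fun z : Phase => unitField B z.1) z :=
    ((hB.contDiffAt_unitField hz).of_le (by norm_num)).comp z contDiffAt_fst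
  have h2 : ContDiffAt ℝ 1 (fun z : Phase => strengthDeriv B z.1) z :=
    (hB.contDiffAt_strengthDeriv hz).comp z contDiffAt_fst
  exact (contDiffAt_snd.smul h1).prodMk (contDiffAt_const.mul h2)

theorem hasFDerivAt_unitField (hB : IsMagneticField U B) (hx : x ∈ U) :
    HasFDerivAt (unitField B) (fderiv ℝ (unitField B) x) x :=
  ((hB.contDiffAt_unitField hx).differentiableAt (by norm_num)).hasFDerivAt

/-- Modulo `b`, the spatial part of the linearised motion is `v_∥` times the linearised fieldline
equation. This is why a commuting field induces a variation of fieldlines. -/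
theorem fderiv_zgcField_fst (hB : IsMagneticField U B) (m μ : ℝ) {z : Phase} (hz : z.1 ∈ U)
    (w : Phase) : (fderiv ℝ (zgcField m μ B) z w).1
      = z.2 • fderiv ℝ (unitField B) z.1 w.1 + w.2 • unitField B z.1 := by
  have h1 : HasFDerivAt (fun z : Phase => z.2 • unitField B z.1) _ z :=
    (hasFDerivAt_snd (𝕜 := ℝ) (E := Space) (F := ℝ) (p := z)).smul
      ((hB.hasFDerivAt_unitField hz).comp z (hasFDerivAt_fst (𝕜 := ℝ) (E := Space) (F := ℝ) (p := z)))
  have h2 := ((hB.contDiffAt_zgcField m μ hz).differentiableAt one_ne_zero).hasFDerivAt.fst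
  simpa using DFunLike.congr_fun (h2.unique h1) w

theorem norm_unitField (hB : IsMagneticField U B) (hx : x ∈ U) : ‖unitField B x‖ = 1 := by
  have : ‖B x‖ ≠ 0 := norm_ne_zero_iff.2 (hB.ne_zero x hx)
  simp [unitField, norm_smul, this]

theorem inner_unitField_self (hB : IsMagneticField U B) (hx : x ∈ U) :
    inner ℝ (unitField B x) (unitField B x) = (1 : ℝ) := by
  rw [real_inner_self_eq_norm_sq, hB.norm_unitField hx, one_pow]

/-- Differentiate `b · b = 1`. -/
theorem inner_fderiv_unitField (hB : IsMagneticField U B) (hx : x ∈ U) (u : Space) :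
    inner ℝ (fderiv ℝ (unitField B) x u) (unitField B x) = (0 : ℝ) := by
  have h1 := (hB.hasFDerivAt_unitField hx).inner ℝ (hB.hasFDerivAt_unitField hx)
  have h2 : (fun y => inner ℝ (unitField B y) (unitField B y)) =ᶠ[𝓝 x] fun _ => (1 : ℝ) := by
    filter_upwards [hB.isOpen.mem_nhds hx] with y hy using hB.inner_unitField_self hy
  have h3 := DFunLike.congr_fun
    (h1.unique ((hasFDerivAt_const (1 : ℝ) x).congr_of_eventuallyEq h2)) u
  simp [fderivInnerCLM_apply, real_inner_comm] at h3
  rw [real_inner_comm]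
  linarith

/-- The other term of `vol_curl_eq` drops because `b` has constant length. What remains is the
curvature vector `b·∇b`, so the component of `u` along `b` does not matter. -/
theorem vol_curl_unitField (hB : IsMagneticField U B) (hx : x ∈ U) (u : Space) :
    vol (curl (unitField B) x) u (unitField B x)
      = - inner ℝ u (fderiv ℝ (unitField B) x (unitField B x)) := by
  rw [vol_curl_eq, hB.inner_fderiv_unitField hx, zero_sub]

theorem inner_perp_unitField (hB : IsMagneticField U B) (hx : x ∈ U) (u : Space) :
    inner ℝ (perp B x u) (unitField B x) = (0 : ℝ) := by
  rw [perp, inner_sub_left, real_inner_smul_left, hB.inner_unitField_self hx, mul_one, sub_self]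

theorem inner_gradStrength (hB : IsMagneticField U B) (hx : x ∈ U) (u : Space) :
    inner ℝ (gradStrength B x) u = fderiv ℝ (fun y => ‖B y‖) x u := by
  have h := ((hB.contDiffAt_strength hx).differentiableAt (by norm_num)).hasGradientAt
  rw [h.hasFDerivAt.fderiv, InnerProductSpace.toDual_apply_apply, gradStrength]

theorem hasFDerivAt_strength (hB : IsMagneticField U B) (hx : x ∈ U) :
    HasFDerivAt (fun y => ‖B y‖) (innerSL ℝ (gradStrength B x)) x := by
  have h := ((hB.contDiffAt_strength hx).differentiableAt (by norm_num)).hasFDerivAt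
  convert! h using 1
  ext u
  rw [innerSL_apply_apply, hB.inner_gradStrength hx]

theorem hasDerivWithinAt_strength (hB : IsMagneticField U B) {c : ℝ → Space} {s : ℝ} {S : Set ℝ}
    (hs : c s ∈ U) (hc : HasDerivWithinAt c (unitField B (c s)) S s) :
    HasDerivWithinAt (fun t => ‖B (c t)‖) (strengthDeriv B (c s)) S s := by
  have := (hB.hasFDerivAt_strength hs).comp_hasDerivWithinAt s hc
  simpa [strengthDeriv, real_inner_comm, Function.comp_def] using this

end IsMagneticField

end Field

/-! ### Commuting flows and the Lie bracket -/

section Commutator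

variable {E : Type*} [NormedAddCommGroup E] [NormedSpace ℝ E]

/-- An integral curve stays near its starting point for a short time. -/
theorem norm_sub_le_of_integralCurve {X : E → E} {z : E} {α : ℝ → E} {C ρ τ : ℝ} (hC : 0 < C)
    (hX : ∀ w, ‖w - z‖ < ρ → ‖X w‖ < C)
    (hα : ∀ t ∈ Icc 0 τ, HasDerivAt α (X (α t)) t) (hρ : ‖α 0 - z‖ + C * τ < ρ) :
    ∀ t ∈ Icc 0 τ, ‖α t - z‖ ≤ ‖α 0 - z‖ + C * t := by
  intro t ht
  refine image_norm_le_of_norm_deriv_right_lt_deriv_boundary (f := fun t => α t - z)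
    (f' := fun t => X (α t)) (a := 0) (b := τ) (B := fun t => ‖α 0 - z‖ + C * t)
    (B' := fun _ => C)
    (fun s hs => ((hα s hs).continuousAt.sub continuousAt_const).continuousWithinAt)
    (fun s hs => ((hα s ⟨hs.1, hs.2.le⟩).sub_const z).hasDerivWithinAt) (by simp)
    (fun s => by simpa using ((hasDerivAt_id s).const_mul C).const_add ‖α 0 - z‖)
    (fun s hs h => hX _ ?_) ht
  rw [h]
  nlinarith [hs.1, hs.2]

/-- The second difference of a two-parameter map tangent to `X` and `Y`. -/
theorem norm_second_difference_le {X Y : E → E} {A : E →L[ℝ] E} {z : E}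
    (hX : HasStrictFDerivAt X A z) (hY : ContinuousAt Y z) {g : ℝ → ℝ → E} {ε : ℝ} (hε : 0 < ε)
    (hgX : ∀ σ ∈ Ico 0 ε, ∀ τ ∈ Ico 0 ε, HasDerivAt (fun s => g s τ) (X (g σ τ)) σ)
    (hgY : ∀ σ ∈ Ico 0 ε, ∀ τ ∈ Ico 0 ε, HasDerivAt (fun t => g σ t) (Y (g σ τ)) τ)
    (hg : ∀ ρ > 0, ∃ δ > 0, ∀ σ ∈ Ico 0 δ, ∀ τ ∈ Ico 0 δ, ‖g σ τ - z‖ < ρ)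
    {η : ℝ} (hη : 0 < η) :
    ∃ δ > 0, ∀ s ∈ Ioo 0 δ,
      ‖g s s - g s 0 - (g 0 s - g 0 0) - (s * s) • A (Y z)‖ ≤ η * (s * s) := by
  -- The minimum with `1` bounds the inner difference by `(‖Y z‖ + 1) s`; the quotient makes the
  -- linearisation error of `X` and the first-order error of the inner difference sum to at most
  -- `η`.
  set η₁ : ℝ := min 1 (η / (‖Y z‖ + 1 + ‖A‖))
  have hpos : 0 < ‖Y z‖ + 1 + ‖A‖ := by positivity
  have hη₁ : 0 < η₁ := by positivity
  have hη₁' : η₁ * (‖Y z‖ + 1 + ‖A‖) ≤ η := by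
    rw [← le_div_iff₀ hpos]
    exact min_le_right _ _
  obtain ⟨ρ₁, hρ₁, h1⟩ := Metric.eventually_nhds_iff.1
    ((hasStrictFDerivAt_iff_isLittleO.1 hX).def hη₁)
  obtain ⟨ρ₂, hρ₂, h2⟩ := Metric.continuousAt_iff.1 hY η₁ hη₁
  obtain ⟨δ, hδ, hgδ⟩ := hg (min ρ₁ ρ₂) (lt_min hρ₁ hρ₂)
  refine ⟨min δ ε, lt_min hδ hε, fun s hs => ?_⟩
  have hsδ : s < δ := hs.2.trans_le (min_le_left _ _)
  have hsε : s < ε := hs.2.trans_le (min_le_right _ _)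
  have hnear : ∀ σ ∈ Icc 0 s, ∀ τ ∈ Icc 0 s, ‖g σ τ - z‖ < min ρ₁ ρ₂ := fun σ hσ τ hτ =>
    hgδ σ ⟨hσ.1, hσ.2.trans_lt hsδ⟩ τ ⟨hτ.1, hτ.2.trans_lt hsδ⟩
  have h0 : (0 : ℝ) ∈ Icc 0 s := ⟨le_rfl, hs.1.le⟩
  have h0' : s ∈ Icc 0 s := ⟨hs.1.le, le_rfl⟩
  have hin : ∀ σ ∈ Icc 0 s, ‖g σ s - g σ 0 - s • Y z‖ ≤ η₁ * s := by
    intro σ hσ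
    have := norm_image_sub_le_of_norm_deriv_le_segment' (f := fun τ => g σ τ - τ • Y z)
      (f' := fun τ => Y (g σ τ) - (1 : ℝ) • Y z) (a := 0) (b := s) (C := η₁)
      (fun τ hτ => ((hgY σ ⟨hσ.1, hσ.2.trans_lt hsε⟩ τ ⟨hτ.1, hτ.2.trans_lt hsε⟩).sub
        ((hasDerivAt_id τ).smul_const (Y z))).hasDerivWithinAt)
      (fun τ hτ => by
        rw [one_smul, ← dist_eq_norm]
        refine (h2 ?_).le
        rw [dist_eq_norm]
        exact (hnear σ hσ τ ⟨hτ.1, hτ.2.le⟩).trans_le (min_le_right _ _)) s h0'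
    simp only [zero_smul, sub_zero] at this
    rwa [sub_right_comm]
  -- The mean value inequality in `σ`, fed with the estimate `hin` of the increment in `τ`, gives
  -- the second difference.
  have := norm_image_sub_le_of_norm_deriv_le_segment'
    (f := fun σ => g σ s - g σ 0 - σ • s • A (Y z))
    (f' := fun σ => X (g σ s) - X (g σ 0) - (1 : ℝ) • s • A (Y z)) (a := 0) (b := s) (C := η * s)
    (fun σ hσ => (((hgX σ ⟨hσ.1, hσ.2.trans_lt hsε⟩ s ⟨hs.1.le, hsε⟩).sub
      (hgX σ ⟨hσ.1, hσ.2.trans_lt hsε⟩ 0 ⟨le_rfl, hε⟩)).sub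
        ((hasDerivAt_id σ).smul_const (s • A (Y z)))).hasDerivWithinAt)
    (fun σ hσ => by
      have hσ' : σ ∈ Icc 0 s := ⟨hσ.1, hσ.2.le⟩
      have e1 : ‖X (g σ s) - X (g σ 0) - A (g σ s - g σ 0)‖ ≤ η₁ * ‖g σ s - g σ 0‖ := by
        refine h1 (y := (g σ s, g σ 0)) ?_
        rw [Prod.dist_eq, dist_eq_norm, dist_eq_norm]
        exact max_lt ((hnear σ hσ' s h0').trans_le (min_le_left _ _))
          ((hnear σ hσ' 0 h0).trans_le (min_le_left _ _))
      have e2 := hin σ hσ'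
      have e3 : ‖g σ s - g σ 0‖ ≤ (‖Y z‖ + 1) * s := by
        have : g σ s - g σ 0 = s • Y z + (g σ s - g σ 0 - s • Y z) := by abel
        rw [this]
        refine (norm_add_le _ _).trans ?_
        rw [norm_smul, Real.norm_of_nonneg hs.1.le]
        have : η₁ * s ≤ 1 * s := mul_le_mul_of_nonneg_right (min_le_left _ _) hs.1.le
        linarith
      have e4 : ‖A (g σ s - g σ 0 - s • Y z)‖ ≤ ‖A‖ * (η₁ * s) :=
        (A.le_opNorm _).trans (mul_le_mul_of_nonneg_left e2 (norm_nonneg _))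
      have e5 : X (g σ s) - X (g σ 0) - (1 : ℝ) • s • A (Y z)
          = (X (g σ s) - X (g σ 0) - A (g σ s - g σ 0)) + A (g σ s - g σ 0 - s • Y z) := by
        rw [map_sub A (g σ s - g σ 0), map_smul]
        simp
      rw [e5]
      refine (norm_add_le _ _).trans ((add_le_add (e1.trans
        (mul_le_mul_of_nonneg_left e3 hη₁.le)) e4).trans ?_)
      have := mul_le_mul_of_nonneg_right hη₁' hs.1.le
      linarith) s h0'
  simp only [zero_smul, sub_zero] at this
  rw [smul_smul] at this
  rwa [sub_right_comm, ← mul_assoc]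

/-- If the flows of two `C¹` vector fields commute then so do their derivatives along each
other, that is, their Lie bracket vanishes. -/
theorem fderiv_apply_comm_of_commuting {X Y : E → E} {z : E} (hX : ContDiffAt ℝ 1 X z)
    (hY : ContDiffAt ℝ 1 Y z) {ε : ℝ} (hε : 0 < ε) {g : ℝ → ℝ → E} (hz : g 0 0 = z)
    (hgX : ∀ σ ∈ Ico 0 ε, ∀ τ ∈ Ico 0 ε, HasDerivAt (fun s => g s τ) (X (g σ τ)) σ)
    (hgY : ∀ σ ∈ Ico 0 ε, ∀ τ ∈ Ico 0 ε, HasDerivAt (fun t => g σ t) (Y (g σ τ)) τ) :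
    fderiv ℝ X z (Y z) = fderiv ℝ Y z (X z) := by
  -- Joint continuity of `g` at the origin follows from speed bounds: go from `z` along `Y`, then
  -- along `X`. Each leg is shorter than a third of the radius.
  have hnear : ∀ ρ > 0, ∃ δ > 0, ∀ σ ∈ Ico 0 δ, ∀ τ ∈ Ico 0 δ, ‖g σ τ - z‖ < ρ := by
    intro ρ hρ
    set C : ℝ := ‖X z‖ + ‖Y z‖ + 1
    have hC : 0 < C := by positivity
    have hXC : ∀ᶠ w in 𝓝 z, ‖X w‖ < C := hX.continuousAt.norm.eventually_lt_const
      (by linarith [norm_nonneg (Y z)])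
    have hYC : ∀ᶠ w in 𝓝 z, ‖Y w‖ < C := hY.continuousAt.norm.eventually_lt_const
      (by linarith [norm_nonneg (X z)])
    obtain ⟨ρ', hρ', h⟩ := Metric.eventually_nhds_iff.1 (hXC.and hYC)
    simp only [dist_eq_norm] at h
    have hδ : 0 < min (ε / 2) (min ρ ρ' / (3 * C)) := by positivity
    refine ⟨min (ε / 2) (min ρ ρ' / (3 * C)), hδ, fun σ hσ τ hτ => ?_⟩
    have key : ∀ t ∈ Ico 0 (min (ε / 2) (min ρ ρ' / (3 * C))),
        C * t < min ρ ρ' / 3 ∧ t < ε := by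
      intro t ht
      have h1 := ht.2.trans_le (min_le_right _ _)
      rw [lt_div_iff₀ (by positivity)] at h1
      exact ⟨by linarith, by linarith [ht.2.trans_le (min_le_left (ε / 2) _)]⟩
    have hmin : 0 < min ρ ρ' := lt_min hρ hρ'
    have hτ' := norm_sub_le_of_integralCurve (X := Y) (z := z) (α := g 0) (ρ := ρ') (τ := τ) hC
      (fun w hw => (h hw).2) (fun t ht => hgY 0 ⟨le_rfl, hε⟩ t ⟨ht.1, ht.2.trans_lt (key τ hτ).2⟩)
      (by rw [hz, sub_self, norm_zero, zero_add]
          linarith [(key τ hτ).1, min_le_right ρ ρ']) τ ⟨hτ.1, le_rfl⟩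
    rw [hz, sub_self, norm_zero, zero_add] at hτ'
    have hσ' := norm_sub_le_of_integralCurve (X := X) (z := z) (α := fun s => g s τ) (ρ := ρ')
      (τ := σ) hC (fun w hw => (h hw).1)
      (fun t ht => hgX t ⟨ht.1, ht.2.trans_lt (key σ hσ).2⟩ τ ⟨hτ.1, (key τ hτ).2⟩)
      (by linarith [(key τ hτ).1, (key σ hσ).1, min_le_right ρ ρ']) σ ⟨hσ.1, le_rfl⟩
    linarith [(key τ hτ).1, (key σ hσ).1, min_le_left ρ ρ']
  have hXs := hX.hasStrictFDerivAt one_ne_zero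
  have hYs := hY.hasStrictFDerivAt one_ne_zero
  by_contra hne
  have hd : 0 < ‖fderiv ℝ X z (Y z) - fderiv ℝ Y z (X z)‖ := norm_pos_iff.2 (sub_ne_zero.2 hne)
  set d := ‖fderiv ℝ X z (Y z) - fderiv ℝ Y z (X z)‖ with hd_def
  -- The same second difference is read in both orders. Two errors of `d / 3` cannot make up a
  -- discrepancy `d`.
  obtain ⟨δ₁, hδ₁, h₁⟩ := norm_second_difference_le hXs hY.continuousAt hε hgX hgY hnear
    (η := d / 3) (by positivity)
  obtain ⟨δ₂, hδ₂, h₂⟩ := norm_second_difference_le (g := fun t s => g s t) hYs hX.continuousAt hε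
    (fun τ hτ σ hσ => hgY σ hσ τ hτ) (fun τ hτ σ hσ => hgX σ hσ τ hτ)
    (fun ρ hρ => by
      obtain ⟨δ, hδ, h⟩ := hnear ρ hρ
      exact ⟨δ, hδ, fun σ hσ τ hτ => h τ hτ σ hσ⟩)
    (η := d / 3) (by positivity)
  set s := min δ₁ δ₂ / 2
  have hs : 0 < s := by positivity
  have hs₁ : s < δ₁ := by
    have := min_le_left δ₁ δ₂
    simp only [s]; linarith
  have hs₂ : s < δ₂ := by
    have := min_le_right δ₁ δ₂
    simp only [s]; linarith
  have e₁ := h₁ s ⟨hs, hs₁⟩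
  have e₂ := h₂ s ⟨hs, hs₂⟩
  have e₃ : ‖(s * s) • (fderiv ℝ X z (Y z) - fderiv ℝ Y z (X z))‖
      ≤ d / 3 * (s * s) + d / 3 * (s * s) := by
    refine le_trans (le_of_eq ?_) ((norm_sub_le _ _).trans (add_le_add e₂ e₁))
    congr 1
    rw [smul_sub]
    abel
  rw [norm_smul, Real.norm_of_nonneg (by positivity), ← hd_def] at e₃
  have : 0 < d * (s * s) := by positivity
  linarith

/-- The two-parameter map `φ s (ψ t z)` is tangent to `X` in `s` by construction, and to `Y` in `t`
because it equals `ψ t (φ s z)`. -/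
theorem FlowsCommuteOn.fderiv_apply_comm {X Y : Phase → Phase} {W : Set Phase}
    (h : FlowsCommuteOn X Y W) {z : Phase} (hz : z ∈ W) (hX : ContDiffAt ℝ 1 X z)
    (hY : ContDiffAt ℝ 1 Y z) : fderiv ℝ X z (Y z) = fderiv ℝ Y z (X z) := by
  obtain ⟨ε, hε, N, hN, φ, ψ, hφ, hψ, hc⟩ := h z hz
  have hmem : ∀ {t}, t ∈ Ico 0 ε → t ∈ Ioo (-ε) ε := fun ht => ⟨by linarith [ht.1], ht.2⟩
  have hz₀ : (0 : ℝ) ∈ Ioo (-ε) ε := ⟨by linarith, hε⟩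
  refine fderiv_apply_comm_of_commuting hX hY hε (g := fun s t => φ s (ψ t z)) ?_ ?_ ?_
  · have h0 := (hψ z (mem_of_mem_nhds hN)).1
    simp [h0, (hφ z (mem_of_mem_nhds hN)).1]
  · intro σ hσ τ hτ
    exact ((hφ _ (hc 0 hz₀ τ (hmem hτ)).2.1).2 σ (hmem hσ)).2
  · intro σ hσ τ hτ
    have e := ((hψ _ (hc σ (hmem hσ) 0 hz₀).1).2 τ (hmem hτ)).2
    rw [← (hc σ (hmem hσ) τ (hmem hτ)).2.2] at e
    refine e.congr_of_eventuallyEq ?_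
    filter_upwards [isOpen_Ioo.mem_nhds (hmem hτ)] with t ht
    exact (hc σ (hmem hσ) t ht).2.2

end Commutator

/-! ### Geometry of segments: nesting, labels and levels -/

namespace Segment

variable {U : Set Space} {B : Space → Space}

/-- The same segment with its arc length shifted by `d`. -/
noncomputable def shift (γ : Segment U B) (d : ℝ) : Segment U B where
  curve s := γ.curve (s + d)
  left := γ.left - d
  right := γ.right - d
  level := γ.level
  left_lt_right := by linarith [γ.left_lt_right]
  mem_domain s hs := γ.mem_domain _ ⟨by linarith [hs.1], by linarith [hs.2]⟩
  tangent s hs := by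
    have hmap : MapsTo (fun s : ℝ => s + d) (Icc (γ.left - d) (γ.right - d))
        (Icc γ.left γ.right) := fun s hs => ⟨by linarith [hs.1], by linarith [hs.2]⟩
    simpa [Function.comp_def] using (γ.tangent _ (hmap hs)).scomp s
      ((hasDerivAt_id s).add_const d).hasDerivWithinAt hmap
  strength_lt s hs := γ.strength_lt _ ⟨by linarith [hs.1], by linarith [hs.2]⟩
  strength_left := by simpa using γ.strength_left
  strength_right := by simpa using γ.strength_right
  turning_left := by simpa using γ.turning_left
  turning_right := by simpa using γ.turning_right

theorem wells_shift (γ : Segment U B) (d : ℝ) : (γ.shift d).wells = γ.wells := by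
  have : (fun s => γ.curve (s + d)) '' Icc (γ.left - d) (γ.right - d)
      = γ.curve '' Icc γ.left γ.right := by
    rw [← image_image γ.curve (fun s => s + d), image_add_const_Icc, sub_add_cancel,
      sub_add_cancel]
  simp only [wells, shift, this]

theorem action_shift (γ : Segment U B) (d : ℝ) : (γ.shift d).action = γ.action := by
  have := intervalIntegral.integral_comp_add_right (a := γ.left - d) (b := γ.right - d)
    (fun s => γ.speed s) d
  simpa [action, speed, shift] using this

theorem left_mem (γ : Segment U B) : γ.left ∈ Icc γ.left γ.right :=
  left_mem_Icc.2 γ.left_lt_right.le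

theorem right_mem (γ : Segment U B) : γ.right ∈ Icc γ.left γ.right :=
  right_mem_Icc.2 γ.left_lt_right.le

theorem continuousOn_curve (γ : Segment U B) : ContinuousOn γ.curve (Icc γ.left γ.right) :=
  fun s hs => (γ.tangent s hs).continuousWithinAt

theorem hasDerivWithinAt_strength (hB : IsMagneticField U B) (γ : Segment U B) {s : ℝ}
    (hs : s ∈ Icc γ.left γ.right) :
    HasDerivWithinAt (fun t => ‖B (γ.curve t)‖) (strengthDeriv B (γ.curve s))
      (Icc γ.left γ.right) s :=
  hB.hasDerivWithinAt_strength (γ.mem_domain s hs) (γ.tangent s hs)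

theorem continuousOn_strength (hB : IsMagneticField U B) (γ : Segment U B) :
    ContinuousOn (fun t => ‖B (γ.curve t)‖) (Icc γ.left γ.right) :=
  fun _ hs => (γ.hasDerivWithinAt_strength hB hs).continuousWithinAt

theorem strength_le (γ : Segment U B) {s : ℝ} (hs : s ∈ Icc γ.left γ.right) :
    ‖B (γ.curve s)‖ ≤ γ.level := by
  rcases eq_or_lt_of_le hs.1 with h | h
  · rw [← h, γ.strength_left]
  · rcases eq_or_lt_of_le hs.2 with h' | h'
    · rw [h', γ.strength_right]
    · exact (γ.strength_lt s ⟨h, h'⟩).le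

theorem continuousOn_speed (hB : IsMagneticField U B) (γ : Segment U B) :
    ContinuousOn γ.speed (Icc γ.left γ.right) :=
  (continuousOn_const.mul (continuousOn_const.sub (γ.continuousOn_strength hB))).sqrt

theorem speed_pos (γ : Segment U B) {s : ℝ} (hs : s ∈ Ioo γ.left γ.right) : 0 < γ.speed s :=
  Real.sqrt_pos.2 (by linarith [γ.strength_lt s hs])

/-- The difference quotients from inside are nonpositive, since `|B|` lies below its end value
there, and transversality excludes zero. -/
theorem strengthDeriv_left_neg (hB : IsMagneticField U B) (γ : Segment U B) :
    strengthDeriv B (γ.curve γ.left) < 0 := by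
  refine lt_of_le_of_ne ?_ γ.turning_left
  have h := (γ.hasDerivWithinAt_strength hB γ.left_mem).mono_of_mem_nhdsWithin
    (Icc_mem_nhdsGE γ.left_lt_right)
  have h' := hasDerivWithinAt_iff_tendsto_slope.1 h
  rw [Ici_sdiff_left] at h'
  refine le_of_tendsto h' ?_
  filter_upwards [Ioo_mem_nhdsGT γ.left_lt_right] with s hs
  rw [slope_def_field]
  exact div_nonpos_of_nonpos_of_nonneg
    (by linarith [γ.strength_lt s hs, γ.strength_left]) (by linarith [hs.1])

theorem strengthDeriv_right_pos (hB : IsMagneticField U B) (γ : Segment U B) :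
    0 < strengthDeriv B (γ.curve γ.right) := by
  refine lt_of_le_of_ne ?_ γ.turning_right.symm
  have h := (γ.hasDerivWithinAt_strength hB γ.right_mem).mono_of_mem_nhdsWithin
    (Icc_mem_nhdsLE γ.left_lt_right)
  have h' := hasDerivWithinAt_iff_tendsto_slope.1 h
  rw [Iic_sdiff_right] at h'
  refine ge_of_tendsto h' ?_
  filter_upwards [Ioo_mem_nhdsLT γ.left_lt_right] with s hs
  rw [slope_def_field]
  exact div_nonneg_of_nonpos
    (by linarith [γ.strength_lt s hs, γ.strength_right]) (by linarith [hs.2])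

/-- Rolle's theorem for `|B|`. Through it, two segments with the same label have a point in common.
-/
theorem wells_nonempty (hB : IsMagneticField U B) (γ : Segment U B) : γ.wells.Nonempty := by
  obtain ⟨s, hs, h⟩ := exists_hasDerivAt_eq_zero γ.left_lt_right (γ.continuousOn_strength hB)
    (by rw [γ.strength_left, γ.strength_right])
    (fun s hs => (γ.hasDerivWithinAt_strength hB (Ioo_subset_Icc_self hs)).hasDerivAt
      (Icc_mem_nhds hs.1 hs.2))
  have hs' := Ioo_subset_Icc_self hs
  exact ⟨_, mem_image_of_mem _ hs', γ.mem_domain s hs', h⟩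

end Segment

/-- Two fieldlines that agree at one point agree on their common interval of definition. -/
theorem fieldline_eqOn {U : Set Space} {B : Space → Space} (hB : IsMagneticField U B)
    {c₁ c₂ : ℝ → Space} {a b t : ℝ} (ht : t ∈ Icc a b)
    (h₁ : ∀ s ∈ Icc a b, c₁ s ∈ U ∧ HasDerivWithinAt c₁ (unitField B (c₁ s)) (Icc a b) s)
    (h₂ : ∀ s ∈ Icc a b, c₂ s ∈ U ∧ HasDerivWithinAt c₂ (unitField B (c₂ s)) (Icc a b) s)
    (h : c₁ t = c₂ t) : EqOn c₁ c₂ (Icc a b) := by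
  have hc₁ : ContinuousOn c₁ (Icc a b) := fun s hs => (h₁ s hs).2.continuousWithinAt
  have hc₂ : ContinuousOn c₂ (Icc a b) := fun s hs => (h₂ s hs).2.continuousWithinAt
  obtain ⟨v, hv, hvc, V, -, hSV, -, hvV⟩ := exists_compactlySupported_eqOn hB.isOpen
    (G := unitField B)
    (fun x hx => ((hB.contDiffAt_unitField hx).of_le (by norm_num)).contDiffWithinAt)
    ((isCompact_Icc.image_of_continuousOn hc₁).union (isCompact_Icc.image_of_continuousOn hc₂))
    (union_subset (image_subset_iff.2 fun s hs => (h₁ s hs).1)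
      (image_subset_iff.2 fun s hs => (h₂ s hs).1))
  obtain ⟨K, hK⟩ := ContDiff.lipschitzWith_of_hasCompactSupport hvc hv one_ne_zero
  have key := eq_zero_of_norm_deriv_le (f := fun s => c₁ s - c₂ s) (K := K + 1)
    (by positivity) ht (by simp [h]) (fun s hs => (h₁ s hs).2.sub (h₂ s hs).2)
    (fun s hs => by
      rw [← hvV (hSV (Or.inl (mem_image_of_mem _ hs))),
        ← hvV (hSV (Or.inr (mem_image_of_mem _ hs)))]
      refine (hK.norm_sub_le _ _).trans (mul_le_mul_of_nonneg_right ?_ (norm_nonneg _))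
      linarith)
  exact fun s hs => sub_eq_zero.1 (key s hs)

namespace Segment

variable {U : Set Space} {B : Space → Space}

theorem curve_eq (hB : IsMagneticField U B) {γ₁ γ₂ : Segment U B} {t : ℝ}
    (h₁ : t ∈ Icc γ₁.left γ₁.right) (h₂ : t ∈ Icc γ₂.left γ₂.right)
    (h : γ₁.curve t = γ₂.curve t) {s : ℝ} (hs₁ : s ∈ Icc γ₁.left γ₁.right)
    (hs₂ : s ∈ Icc γ₂.left γ₂.right) : γ₁.curve s = γ₂.curve s := by
  have hsub₁ : Icc (max γ₁.left γ₂.left) (min γ₁.right γ₂.right) ⊆ Icc γ₁.left γ₁.right :=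
    Icc_subset_Icc (le_max_left _ _) (min_le_left _ _)
  have hsub₂ : Icc (max γ₁.left γ₂.left) (min γ₁.right γ₂.right) ⊆ Icc γ₂.left γ₂.right :=
    Icc_subset_Icc (le_max_right _ _) (min_le_right _ _)
  exact fieldline_eqOn hB ⟨max_le h₁.1 h₂.1, le_min h₁.2 h₂.2⟩
    (fun s hs => ⟨γ₁.mem_domain s (hsub₁ hs), (γ₁.tangent s (hsub₁ hs)).mono hsub₁⟩)
    (fun s hs => ⟨γ₂.mem_domain s (hsub₂ hs), (γ₂.tangent s (hsub₂ hs)).mono hsub₂⟩) h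
    ⟨max_le hs₁.1 hs₂.1, le_min hs₁.2 hs₂.2⟩

/-- Of two segments of the same fieldline, the one of higher level contains the other. -/
theorem nested (hB : IsMagneticField U B) {γ₁ γ₂ : Segment U B} {t : ℝ}
    (h₁ : t ∈ Icc γ₁.left γ₁.right) (h₂ : t ∈ Icc γ₂.left γ₂.right)
    (h : γ₁.curve t = γ₂.curve t) (hl : γ₁.level ≤ γ₂.level) :
    γ₂.left ≤ γ₁.left ∧ γ₁.right ≤ γ₂.right := by
  constructor
  · by_contra! hlt
    have hm : γ₂.left ∈ Icc γ₁.left γ₁.right := ⟨hlt.le, h₂.1.trans h₁.2⟩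
    have hc := curve_eq hB h₁ h₂ h hm γ₂.left_mem
    -- If the left end of `γ₂` were the right end of `γ₁`, then `|B|'` would have both signs there.
    -- Otherwise it is interior to `γ₁`, where `|B|` is below the lower level.
    rcases eq_or_lt_of_le hm.2 with he | he
    · have := γ₂.strengthDeriv_left_neg hB
      rw [← hc, he] at this
      exact this.not_gt (γ₁.strengthDeriv_right_pos hB)
    · have := γ₁.strength_lt _ ⟨hlt, he⟩
      rw [hc, γ₂.strength_left] at this
      linarith
  · by_contra! hlt
    have hm : γ₂.right ∈ Icc γ₁.left γ₁.right := ⟨h₁.1.trans h₂.2, hlt.le⟩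
    have hc := curve_eq hB h₁ h₂ h hm γ₂.right_mem
    rcases eq_or_lt_of_le hm.1 with he | he
    · have := γ₂.strengthDeriv_right_pos hB
      rw [← hc, ← he] at this
      exact this.not_gt (γ₁.strengthDeriv_left_neg hB)
    · have := γ₁.strength_lt _ ⟨he, hlt⟩
      rw [hc, γ₂.strength_right] at this
      linarith

/-- The origin of arc length is arbitrary, so two segments through a point can be aligned to reach
it at the same parameter. -/
theorem exists_shift {γ₁ γ₂ : Segment U B} {x : Space}
    (h₁ : x ∈ γ₁.curve '' Icc γ₁.left γ₁.right) (h₂ : x ∈ γ₂.curve '' Icc γ₂.left γ₂.right) :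
    ∃ d t, t ∈ Icc γ₁.left γ₁.right ∧ t ∈ Icc (γ₂.shift d).left (γ₂.shift d).right ∧
      γ₁.curve t = (γ₂.shift d).curve t := by
  obtain ⟨t₁, ht₁, e₁⟩ := h₁
  obtain ⟨t₂, ht₂, e₂⟩ := h₂
  refine ⟨t₂ - t₁, t₁, ht₁, ⟨?_, ?_⟩, ?_⟩
  · simp only [shift]; linarith [ht₂.1]
  · simp only [shift]; linarith [ht₂.2]
  · simp [shift, e₁, e₂]

/-- Two segments of the same level through the same point have the same label and action. -/
theorem wells_eq_and_action_eq (hB : IsMagneticField U B) {γ₁ γ₂ : Segment U B} {x : Space}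
    (h₁ : x ∈ γ₁.curve '' Icc γ₁.left γ₁.right) (h₂ : x ∈ γ₂.curve '' Icc γ₂.left γ₂.right)
    (hl : γ₁.level = γ₂.level) : γ₁.wells = γ₂.wells ∧ γ₁.action = γ₂.action := by
  obtain ⟨d, t, ht₁, ht₂, ht⟩ := exists_shift h₁ h₂
  rw [← wells_shift γ₂ d, ← action_shift γ₂ d]
  have hl' : γ₁.level = (γ₂.shift d).level := hl
  generalize γ₂.shift d = γ₃ at *
  obtain ⟨a₁, b₁⟩ := nested hB ht₁ ht₂ ht hl'.le
  obtain ⟨a₂, b₂⟩ := nested hB ht₂ ht₁ ht.symm hl'.ge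
  have e₁ := le_antisymm a₁ a₂
  have e₂ := le_antisymm b₁ b₂
  have hc : EqOn γ₁.curve γ₃.curve (Icc γ₁.left γ₁.right) := fun s hs =>
    curve_eq hB ht₁ ht₂ ht hs (by rwa [e₁, ← e₂])
  constructor
  · rw [wells, wells, hc.image_eq, e₁, e₂]
  · rw [action, action, e₁, ← e₂]
    refine intervalIntegral.integral_congr fun s hs => ?_
    rw [uIcc_of_le γ₁.left_lt_right.le] at hs
    simp only [speed, hc hs, hl']

/-- Raising the level enlarges both the interval and the integrand. This is the uniqueness behind
the reduced Hamiltonian. -/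
theorem action_lt_action (hB : IsMagneticField U B) {γ₁ γ₂ : Segment U B} {x : Space}
    (h₁ : x ∈ γ₁.curve '' Icc γ₁.left γ₁.right) (h₂ : x ∈ γ₂.curve '' Icc γ₂.left γ₂.right)
    (hl : γ₁.level < γ₂.level) : γ₁.action < γ₂.action := by
  obtain ⟨d, t, ht₁, ht₂, ht⟩ := exists_shift h₁ h₂
  rw [← action_shift γ₂ d]
  have hl' : γ₁.level < (γ₂.shift d).level := hl
  generalize γ₂.shift d = γ₃ at *
  obtain ⟨hL, hR⟩ := nested hB ht₁ ht₂ ht hl'.le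
  have hsub : Icc γ₁.left γ₁.right ⊆ Icc γ₃.left γ₃.right := Icc_subset_Icc hL hR
  have hc : ∀ s ∈ Icc γ₁.left γ₁.right, γ₁.curve s = γ₃.curve s := fun s hs =>
    curve_eq hB ht₁ ht₂ ht hs (hsub hs)
  have hlt : ∀ s ∈ Icc γ₁.left γ₁.right, γ₁.speed s < γ₃.speed s := fun s hs => by
    refine Real.sqrt_lt_sqrt (by linarith [γ₁.strength_le hs]) ?_
    rw [hc s hs]
    linarith
  calc γ₁.action < ∫ s in γ₁.left..γ₁.right, γ₃.speed s :=
        intervalIntegral.integral_lt_integral_of_continuousOn_of_le_of_exists_lt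
          γ₁.left_lt_right (γ₁.continuousOn_speed hB) ((γ₃.continuousOn_speed hB).mono hsub)
          (fun s hs => (hlt s (Ioc_subset_Icc_self hs)).le) ⟨_, γ₁.left_mem, hlt _ γ₁.left_mem⟩
    _ ≤ γ₃.action := by
        refine intervalIntegral.integral_mono_interval hL γ₁.left_lt_right.le hR
          (Eventually.of_forall fun s => Real.sqrt_nonneg _) ?_
        exact ContinuousOn.intervalIntegrable_of_Icc γ₃.left_lt_right.le
          (γ₃.continuousOn_speed hB)

theorem reducedHamiltonian_eq (hB : IsMagneticField U B) (γ : Segment U B) :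
    reducedHamiltonian U B γ.action γ.wells = γ.level := by
  obtain ⟨γ', hw, hl, ha⟩ := Classical.epsilon_spec
    (p := fun h : ℝ => ∃ γ' : Segment U B,
      γ'.wells = γ.wells ∧ γ'.level = h ∧ γ'.action = γ.action) ⟨γ.level, γ, rfl, rfl, rfl⟩
  -- The chosen segment shares a point of the label with `γ`, so different levels would force
  -- different actions.
  obtain ⟨x, hx⟩ := γ.wells_nonempty hB
  have hx' : x ∈ γ'.wells := by rwa [hw]
  change γ'.level = reducedHamiltonian U B γ.action γ.wells at hl
  rw [← hl]
  rcases lt_trichotomy γ'.level γ.level with h | h | h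
  · exact absurd ha (action_lt_action hB hx'.1 hx.1 h).ne
  · exact h
  · exact absurd ha (action_lt_action hB hx.1 hx'.1 h).ne'

theorem wellsAt_eq (hB : IsMagneticField U B) {m μ : ℝ} {γ : Segment U B} {z : Phase}
    (hz : γ.Carries m μ z) : wellsAt m μ U B z = γ.wells := by
  have hb : IsBouncing m μ U B z := ⟨γ, hz⟩
  rw [wellsAt, dif_pos hb]
  exact (wells_eq_and_action_eq hB hb.choose_spec.1 hz.1
    (hb.choose_spec.2.symm.trans hz.2)).1

end Segment

/-! ### Integrals of square roots with simple zeros -/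

section SqrtIntegral

/-- For nonnegative arguments this is `u - w = (√u - √w)(√u + √w)`; the other signs use that `√` is
zero on negative numbers. The constant depends on `w` only, which supplies the dominating function
at a fixed base parameter. -/
theorem abs_sqrt_sub_sqrt_le {u w : ℝ} (hw : w ≠ 0) :
    |√u - √w| ≤ |u - w| * (√|w|)⁻¹ := by
  have hpos : 0 < √|w| := Real.sqrt_pos.2 (abs_pos.2 hw)
  rw [← div_eq_mul_inv, le_div_iff₀ hpos]
  rcases lt_or_gt_of_ne hw with h | h
  · rw [Real.sqrt_eq_zero_of_nonpos h.le, sub_zero, abs_of_nonneg (Real.sqrt_nonneg u)]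
    rcases le_total u 0 with hu | hu
    · rw [Real.sqrt_eq_zero_of_nonpos hu, zero_mul]
      exact abs_nonneg _
    · rw [abs_of_neg h, abs_of_nonneg (by linarith)]
      have h1 := Real.sq_sqrt hu
      have h2 := Real.sq_sqrt (neg_nonneg.2 h.le)
      nlinarith [sq_nonneg (√u - √(-w)), Real.sqrt_nonneg u, Real.sqrt_nonneg (-w),
        mul_nonneg (Real.sqrt_nonneg u) (Real.sqrt_nonneg (-w))]
  · rw [abs_of_pos h]
    rcases le_total u 0 with hu | hu
    · rw [Real.sqrt_eq_zero_of_nonpos hu, zero_sub, abs_neg, abs_of_nonneg (Real.sqrt_nonneg w),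
        Real.mul_self_sqrt h.le, abs_of_nonpos (by linarith)]
      linarith
    · have : u - w = (√u - √w) * (√u + √w) := by
        have h1 := Real.sq_sqrt hu
        have h2 := Real.sq_sqrt h.le
        linarith
      rw [this, abs_mul, abs_of_nonneg (by positivity : 0 ≤ √u + √w)]
      exact mul_le_mul_of_nonneg_left (by linarith [Real.sqrt_nonneg u]) (abs_nonneg _)

theorem intervalIntegrable_inv_sqrt_abs_sub (d a b : ℝ) :
    IntervalIntegrable (fun s => (√|s - d|)⁻¹) volume a b := by
  have h : IntervalIntegrable (fun s : ℝ => ‖s ^ (-1 / 2 : ℝ)‖ + ‖(-s) ^ (-1 / 2 : ℝ)‖) volume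
      (a - d) (b - d) := by
    have h1 : ∀ a b : ℝ, IntervalIntegrable (fun s : ℝ => s ^ (-1 / 2 : ℝ)) volume a b :=
      fun a b => intervalIntegral.intervalIntegrable_rpow' (by norm_num)
    have h2 : IntervalIntegrable (fun s : ℝ => (-s) ^ (-1 / 2 : ℝ)) volume (a - d) (b - d) := by
      simpa using (IntervalIntegrable.iff_comp_neg (by simp)).1 (h1 (-(a - d)) (-(b - d)))
    exact (h1 _ _).norm.add h2.norm
  have h' := h.comp_sub_right d
  simp only [sub_add_cancel] at h'
  refine h'.mono_fun (by fun_prop) (Eventually.of_forall fun s => ?_)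
  have key : ∀ x : ℝ, 0 ≤ x → (√x)⁻¹ = ‖x ^ (-1 / 2 : ℝ)‖ := by
    intro x hx
    rw [Real.norm_of_nonneg (Real.rpow_nonneg hx _), Real.sqrt_eq_rpow, ← Real.rpow_neg hx]
    norm_num
  simp only
  rw [Real.norm_of_nonneg (by positivity), Real.norm_of_nonneg (by positivity)]
  rcases le_total 0 (s - d) with hs | hs
  · rw [abs_of_nonneg hs, key _ hs]
    exact le_add_of_nonneg_right (norm_nonneg _)
  · rw [abs_of_nonpos hs, key _ (neg_nonneg.2 hs)]
    exact le_add_of_nonneg_left (norm_nonneg _)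

variable {P : Type*} [NormedAddCommGroup P] [NormedSpace ℝ P]

/-- At each point, the inverse root of the distance to the nearer of `l` and `r` dominates up to a
constant, and both such functions are integrable. -/
theorem intervalIntegrable_inv_sqrt_of_linear_growth {q : ℝ → ℝ} {a b l r c : ℝ} (hab : a ≤ b)
    (hc : 0 < c) (hq : ContinuousOn q (Icc a b))
    (hgrow : ∀ s ∈ Icc a b, c * min |s - l| |s - r| ≤ |q s|) :
    IntervalIntegrable (fun s => (√|q s|)⁻¹) volume a b := by
  have h := ((intervalIntegrable_inv_sqrt_abs_sub l a b).add
    (intervalIntegrable_inv_sqrt_abs_sub r a b)).const_mul (√c)⁻¹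
  refine h.mono_fun ?_ ?_
  · rw [uIoc_of_le hab]
    have : AEMeasurable q (volume.restrict (Ioc a b)) :=
      (hq.mono Ioc_subset_Icc_self).aemeasurable measurableSet_Ioc
    exact (this.abs.sqrt.inv).aestronglyMeasurable
  · rw [uIoc_of_le hab]
    have hne : ∀ d : ℝ, ∀ᵐ s ∂(volume.restrict (Ioc a b)), s ≠ d := fun d =>
      ae_restrict_of_ae (Measure.ae_ne volume d)
    filter_upwards [hne l, hne r, ae_restrict_mem measurableSet_Ioc] with s hl hr hs
    have hl' : 0 < |s - l| := abs_pos.2 (sub_ne_zero.2 hl)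
    have hr' : 0 < |s - r| := abs_pos.2 (sub_ne_zero.2 hr)
    rw [Real.norm_of_nonneg (by positivity), Real.norm_of_nonneg (by positivity)]
    have h1 : (√|q s|)⁻¹ ≤ (√(c * min |s - l| |s - r|))⁻¹ :=
      inv_anti₀ (Real.sqrt_pos.2 (by positivity))
        (Real.sqrt_le_sqrt (hgrow s (Ioc_subset_Icc_self hs)))
    refine h1.trans ?_
    rw [Real.sqrt_mul hc.le, mul_inv]
    refine mul_le_mul_of_nonneg_left ?_ (by positivity)
    rcases min_choice |s - l| |s - r| with h | h <;> rw [h]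
    · exact le_add_of_nonneg_right (by positivity)
    · exact le_add_of_nonneg_left (by positivity)

/-- The integral of `√(2 f)` depends differentiably on parameters of `f` when `f` has simple
zeros. -/
theorem hasFDerivAt_integral_sqrt {f : P → ℝ → ℝ} {f' : ℝ → P →L[ℝ] ℝ} {p₀ : P}
    {a b l r c C : ℝ} (hab : a ≤ b) (hc : 0 < c)
    (hcont : ∀ᶠ p in 𝓝 p₀, ContinuousOn (f p) (Icc a b))
    (hlip : ∀ᶠ p in 𝓝 p₀, ∀ s ∈ Icc a b, |f p s - f p₀ s| ≤ C * ‖p - p₀‖)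
    (hder : ∀ s ∈ Icc a b, HasFDerivAt (fun p => f p s) (f' s) p₀)
    (hcont' : ContinuousOn f' (Icc a b))
    (hgrow : ∀ s ∈ Icc a b, c * min |s - l| |s - r| ≤ |f p₀ s|) :
    IntervalIntegrable (fun s => (√(2 * f p₀ s))⁻¹ • f' s) volume a b ∧
      HasFDerivAt (fun p => ∫ s in a..b, √(2 * f p s))
        (∫ s in a..b, (√(2 * f p₀ s))⁻¹ • f' s) p₀ := by
  have hcont₀ := hcont.self_of_nhds
  have hmeas : ∀ p, ContinuousOn (f p) (Icc a b) →
      AEMeasurable (fun s => √(2 * f p s)) (volume.restrict (Ioc a b)) := fun p hp =>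
    (((hp.mono Ioc_subset_Icc_self).aemeasurable measurableSet_Ioc).const_mul 2).sqrt
  have hinv := intervalIntegrable_inv_sqrt_of_linear_growth (q := fun s => 2 * f p₀ s) (l := l)
    (r := r) (c := 2 * c) hab (by positivity) (continuousOn_const.mul hcont₀)
    (fun s hs => by
      rw [abs_mul, abs_two, mul_assoc]
      exact mul_le_mul_of_nonneg_left (hgrow s hs) two_pos.le)
  have hne : ∀ d : ℝ, ∀ᵐ s ∂(volume.restrict (Ioc a b)), s ≠ d := fun d =>
    ae_restrict_of_ae (Measure.ae_ne volume d)
  -- By linear growth `f p₀` can vanish only at `l` and `r`, a null set.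
  have hnz : ∀ᵐ s ∂(volume.restrict (Ioc a b)), s ∈ Icc a b ∧ 2 * f p₀ s ≠ 0 := by
    filter_upwards [hne l, hne r, ae_restrict_mem measurableSet_Ioc] with s hl hr hs
    have hl' : 0 < |s - l| := abs_pos.2 (sub_ne_zero.2 hl)
    have hr' : 0 < |s - r| := abs_pos.2 (sub_ne_zero.2 hr)
    have hs' := Ioc_subset_Icc_self hs
    have := (by positivity : 0 < c * min |s - l| |s - r|).trans_le (hgrow s hs')
    exact ⟨hs', mul_ne_zero two_ne_zero (abs_pos.1 this)⟩
  have := hasFDerivAt_integral_of_dominated_loc_of_lip' (μ := volume.restrict (Ioc a b))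
    (F := fun p s => √(2 * f p s)) (F' := fun s => (√(2 * f p₀ s))⁻¹ • f' s) (x₀ := p₀)
    (bound := fun s => 2 * C * (√|2 * f p₀ s|)⁻¹) (hcont.and hlip)
    (fun p hp => (hmeas p hp.1).aestronglyMeasurable)
    ((continuousOn_const.mul hcont₀).sqrt.integrableOn_Icc.mono_set Ioc_subset_Icc_self)
    ((hmeas p₀ hcont₀).inv.aestronglyMeasurable.smul
      ((hcont'.mono Ioc_subset_Icc_self).aestronglyMeasurable measurableSet_Ioc))
    (by
      filter_upwards [hnz] with s hs p hp
      refine (abs_sqrt_sub_sqrt_le hs.2).trans ?_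
      rw [mul_right_comm]
      refine mul_le_mul_of_nonneg_right ?_ (by positivity)
      rw [← mul_sub, abs_mul, abs_two, mul_assoc]
      exact mul_le_mul_of_nonneg_left (hp.2 s hs.1) two_pos.le)
    ((intervalIntegrable_iff_integrableOn_Ioc_of_le hab).1 (hinv.const_mul (2 * C)))
    (by
      filter_upwards [hnz] with s hs
      -- The formula also holds where `f p₀ s` is negative: the root is locally zero in `p`, and
      -- `0⁻¹ = 0` gives derivative zero.
      convert! ((hder s hs.1).const_mul 2).sqrt hs.2 using 1
      rw [smul_smul]
      congr 1
      field_simp)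
  simp only [intervalIntegral.integral_of_le hab]
  exact ⟨(intervalIntegrable_iff_integrableOn_Ioc_of_le hab).2 this.1, this.2⟩

end SqrtIntegral

/-- A function that increases, stays positive and then decreases has exactly two zeros, both
simple. -/
theorem exists_zeros_of_single_well {q q' : ℝ → ℝ} {a b l₁ r₁ : ℝ} (hal : a < l₁) (hlr : l₁ < r₁)
    (hrb : r₁ < b) (hq : ∀ s ∈ Icc a b, HasDerivWithinAt q (q' s) (Icc a b) s)
    (hl : ∀ s ∈ Icc a l₁, 0 < q' s) (hr : ∀ s ∈ Icc r₁ b, q' s < 0) (ha : q a < 0) (hb : q b < 0)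
    (hm : ∀ s ∈ Icc l₁ r₁, 0 < q s) :
    ∃ l ∈ Ioo a l₁, ∃ r ∈ Ioo r₁ b, q l = 0 ∧ q r = 0 ∧ (∀ s ∈ Ioo l r, 0 < q s) ∧
      (∀ s ∈ Ico a l, q s < 0) ∧ ∀ s ∈ Ioc r b, q s < 0 := by
  have hsubl : Icc a l₁ ⊆ Icc a b := Icc_subset_Icc_right (by linarith)
  have hsubr : Icc r₁ b ⊆ Icc a b := Icc_subset_Icc_left (by linarith)
  have hc : ContinuousOn q (Icc a b) := fun s hs => (hq s hs).continuousWithinAt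
  have hmono : StrictMonoOn q (Icc a l₁) := by
    refine strictMonoOn_of_hasDerivWithinAt_pos (f' := q') (convex_Icc a l₁) (hc.mono hsubl)
      (fun s hs => (hq s (hsubl (interior_subset hs))).mono (interior_subset.trans hsubl))
      (fun s hs => hl s (interior_subset hs))
  have hanti : StrictAntiOn q (Icc r₁ b) := by
    refine strictAntiOn_of_hasDerivWithinAt_neg (f' := q') (convex_Icc r₁ b) (hc.mono hsubr)
      (fun s hs => (hq s (hsubr (interior_subset hs))).mono (interior_subset.trans hsubr))
      (fun s hs => hr s (interior_subset hs))
  obtain ⟨l, hl, hl0⟩ := intermediate_value_Ioo hal.le (hc.mono hsubl)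
    ⟨ha, hm l₁ ⟨le_rfl, hlr.le⟩⟩
  obtain ⟨r, hr, hr0⟩ := intermediate_value_Ioo' hrb.le (hc.mono hsubr)
    ⟨hb, hm r₁ ⟨hlr.le, le_rfl⟩⟩
  refine ⟨l, hl, r, hr, hl0, hr0, fun s hs => ?_, fun s hs => ?_, fun s hs => ?_⟩
  · rcases le_total s l₁ with h | h
    · rw [← hl0]
      exact hmono ⟨hl.1.le, hl.2.le⟩ ⟨by linarith [hl.1, hs.1], h⟩ hs.1
    · rcases le_total s r₁ with h' | h'
      · exact hm s ⟨h, h'⟩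
      · rw [← hr0]
        exact hanti ⟨h', by linarith [hr.2, hs.2]⟩ ⟨hr.1.le, hr.2.le⟩ hs.2
  · rw [← hl0]
    exact hmono ⟨hs.1, by linarith [hl.2, hs.2]⟩ ⟨hl.1.le, hl.2.le⟩ hs.2
  · rw [← hr0]
    exact hanti ⟨hr.1.le, hr.2.le⟩ ⟨by linarith [hr.1, hs.1], hs.2⟩ hs.1

/-- Lower bound for the growth of a function with a derivative bounded below. -/
theorem mul_abs_sub_le_abs_sub {q q' : ℝ → ℝ} {a b c : ℝ} (hc : 0 < c)
    (hq : ∀ s ∈ Icc a b, HasDerivWithinAt q (q' s) (Icc a b) s)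
    (hq' : ∀ s ∈ Icc a b, c < q' s) {s t : ℝ} (hs : s ∈ Icc a b) (ht : t ∈ Icc a b) :
    c * |s - t| ≤ |q s - q t| := by
  have hmono : MonotoneOn (fun s => q s - c * s) (Icc a b) := by
    refine monotoneOn_of_hasDerivWithinAt_nonneg (f' := fun s => q' s - c * 1) (convex_Icc a b)
      (fun s hs => ((hq s hs).continuousWithinAt.sub (by fun_prop)))
      (fun s hs => ((hq s (interior_subset hs)).mono interior_subset).sub
        ((hasDerivAt_id s).hasDerivWithinAt.const_mul c))
      (fun s hs => by linarith [hq' s (interior_subset hs)])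
  rcases le_total s t with h | h
  · have := hmono hs ht h
    simp only at this
    rw [abs_of_nonpos (by linarith), abs_of_nonpos (by nlinarith)]
    linarith
  · have := hmono ht hs h
    simp only at this
    rw [abs_of_nonneg (by linarith), abs_of_nonneg (by nlinarith)]
    linarith

/-! ### Families of fieldlines near a segment -/

namespace Segment

variable {U : Set Space} {B : Space → Space}

/-- A family of fieldlines near a segment, with the point at arc length `s₀` as parameter. -/
structure IsNearbyFamily (γ : Segment U B) (s₀ a b C : ℝ) (α : Space → ℝ → Space)
    (D : ℝ → Space →L[ℝ] Space) : Prop where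
  lt_left : a < γ.left
  right_lt : γ.right < b
  eq_curve : ∀ s ∈ Icc γ.left γ.right, α (γ.curve s₀) s = γ.curve s
  fieldline : ∀ᶠ x in 𝓝 (γ.curve s₀), α x s₀ = x ∧ ∀ s ∈ Icc a b,
    α x s ∈ U ∧ HasDerivWithinAt (α x) (unitField B (α x s)) (Icc a b) s
  lipschitz : ∀ x, ∀ s ∈ Icc a b, ‖α x s - α (γ.curve s₀) s‖ ≤ C * ‖x - γ.curve s₀‖
  variation_start : D s₀ = ContinuousLinearMap.id ℝ Space
  variation : ∀ s ∈ Icc a b, HasDerivWithinAt D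
    ((fderiv ℝ (unitField B) (α (γ.curve s₀) s)).comp (D s)) (Icc a b) s
  hasFDerivAt : ∀ s ∈ Icc a b, HasFDerivAt (fun x => α x s) (D s) (γ.curve s₀)

theorem IsNearbyFamily.shrink {γ : Segment U B} {s₀ a b C : ℝ} {α : Space → ℝ → Space}
    {D : ℝ → Space →L[ℝ] Space} (h : γ.IsNearbyFamily s₀ a b C α D) {a' b' : ℝ}
    (ha : a ≤ a') (hb : b' ≤ b) (ha' : a' < γ.left) (hb' : γ.right < b') :
    γ.IsNearbyFamily s₀ a' b' C α D :=
  have hsub : Icc a' b' ⊆ Icc a b := Icc_subset_Icc ha hb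
  { lt_left := ha'
    right_lt := hb'
    eq_curve := h.eq_curve
    fieldline := h.fieldline.mono fun _ hx =>
      ⟨hx.1, fun s hs => ⟨(hx.2 s (hsub hs)).1, (hx.2 s (hsub hs)).2.mono hsub⟩⟩
    lipschitz := fun x s hs => h.lipschitz x s (hsub hs)
    variation_start := h.variation_start
    variation := fun s hs => (h.variation s (hsub hs)).mono hsub
    hasFDerivAt := fun s hs => h.hasFDerivAt s (hsub hs) }

theorem eventually_forall_mem_of_lipschitz {α : Space → ℝ → Space} {x₀ : Space} {a b C : ℝ}
    (hC : ∀ x, ∀ s ∈ Icc a b, ‖α x s - α x₀ s‖ ≤ C * ‖x - x₀‖)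
    (hc : ContinuousOn (α x₀) (Icc a b)) {V : Set Space} (hV : IsOpen V)
    (hαV : ∀ s ∈ Icc a b, α x₀ s ∈ V) : ∀ᶠ x in 𝓝 x₀, ∀ s ∈ Icc a b, α x s ∈ V := by
  obtain ⟨δ, hδ, hsub⟩ := (isCompact_Icc.image_of_continuousOn hc).exists_thickening_subset_open
    hV (image_subset_iff.2 hαV)
  have hball : ∀ᶠ x in 𝓝 x₀, C * ‖x - x₀‖ < δ := by
    have h : Continuous fun x => C * ‖x - x₀‖ := by fun_prop
    have := h.tendsto x₀
    rw [sub_self, norm_zero, mul_zero] at this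
    exact this.eventually_lt_const hδ
  filter_upwards [hball] with x hx s hs
  refine hsub (Metric.mem_thickening_iff.2 ⟨_, mem_image_of_mem _ hs, ?_⟩)
  rw [dist_eq_norm]
  exact (hC x s hs).trans_lt hx

/-- Cut off `b` away from the segment to obtain a globally defined flow. The window is then
shortened until the central curve stays where the cut-off field equals `b`; uniform closeness keeps
nearby curves there too, so they are true fieldlines. -/
theorem exists_isNearbyFamily (hB : IsMagneticField U B) (γ : Segment U B) {s₀ : ℝ}
    (hs₀ : s₀ ∈ Icc γ.left γ.right) : ∃ a b C α D, γ.IsNearbyFamily s₀ a b C α D := by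
  obtain ⟨v, hv, hvc, V, hV, hSV, hVU, hvV⟩ := exists_compactlySupported_eqOn hB.isOpen
    (G := unitField B)
    (fun x hx => ((hB.contDiffAt_unitField hx).of_le (by norm_num)).contDiffWithinAt)
    (isCompact_Icc.image_of_continuousOn γ.continuousOn_curve)
    (image_subset_iff.2 γ.mem_domain)
  have hγV : ∀ s ∈ Icc γ.left γ.right, γ.curve s ∈ V := fun s hs => hSV (mem_image_of_mem _ hs)
  obtain ⟨α, C, hC, hα₀, hα, hlip, hD⟩ := exists_flow hv hvc (a := γ.left - 1)
    (b := γ.right + 1) (t₀ := s₀) ⟨by linarith [hs₀.1], by linarith [hs₀.2]⟩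
  obtain ⟨D, hD₀, hD, hDα⟩ := hD (γ.curve s₀)
  have hsub : Icc γ.left γ.right ⊆ Icc (γ.left - 1) (γ.right + 1) :=
    Icc_subset_Icc (by linarith) (by linarith)
  obtain ⟨K, hK⟩ := ContDiff.lipschitzWith_of_hasCompactSupport hvc hv one_ne_zero
  have heq : ∀ s ∈ Icc γ.left γ.right, α (γ.curve s₀) s = γ.curve s := by
    intro s hs
    refine sub_eq_zero.1 (eq_zero_of_norm_deriv_le (f := fun s => α (γ.curve s₀) s - γ.curve s)
      (K := K + 1) (by positivity) hs₀ (by simp [hα₀])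
      (fun t ht => ((hα _ t (hsub ht)).mono hsub).sub (γ.tangent t ht)) (fun t ht => ?_) s hs)
    rw [← hvV (hγV t ht)]
    refine (hK.norm_sub_le _ _).trans (mul_le_mul_of_nonneg_right ?_ (norm_nonneg _))
    linarith
  have hcα : ContinuousOn (α (γ.curve s₀)) (Icc (γ.left - 1) (γ.right + 1)) :=
    fun s hs => (hα _ s hs).continuousWithinAt
  have hnhds : ∀ s ∈ Icc γ.left γ.right, ∀ᶠ t in 𝓝 s, α (γ.curve s₀) t ∈ V := fun s hs =>
    (hcα.continuousAt (Icc_mem_nhds (by linarith [hs.1]) (by linarith [hs.2]))).eventually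
      (hV.mem_nhds (by rw [heq s hs]; exact hγV s hs))
  obtain ⟨δ₁, hδ₁, h₁⟩ := Metric.eventually_nhds_iff.1 (hnhds γ.left γ.left_mem)
  obtain ⟨δ₂, hδ₂, h₂⟩ := Metric.eventually_nhds_iff.1 (hnhds γ.right γ.right_mem)
  set δ := min 1 (min δ₁ δ₂) / 2
  have hmin : 0 < min 1 (min δ₁ δ₂) := lt_min one_pos (lt_min hδ₁ hδ₂)
  have hδ : 0 < δ := by positivity
  have hδ1 : δ < 1 := by
    have := min_le_left 1 (min δ₁ δ₂)
    simp only [δ]; linarith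
  have hδ2 : δ < min δ₁ δ₂ := by
    have := min_le_right 1 (min δ₁ δ₂)
    simp only [δ]; linarith
  have hsub' : Icc (γ.left - δ) (γ.right + δ) ⊆ Icc (γ.left - 1) (γ.right + 1) :=
    Icc_subset_Icc (by linarith) (by linarith)
  have hmem : ∀ s ∈ Icc (γ.left - δ) (γ.right + δ), α (γ.curve s₀) s ∈ V := by
    intro s hs
    rcases lt_or_ge s γ.left with h | h
    · refine h₁ ?_
      rw [Real.dist_eq, abs_of_neg (by linarith)]
      linarith [hs.1, min_le_left δ₁ δ₂]
    · rcases le_or_gt s γ.right with h' | h'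
      · rw [heq s ⟨h, h'⟩]
        exact hγV s ⟨h, h'⟩
      · refine h₂ ?_
        rw [Real.dist_eq, abs_of_pos (by linarith)]
        linarith [hs.2, min_le_right δ₁ δ₂]
  refine ⟨γ.left - δ, γ.right + δ, C, α, D, by linarith, by linarith, heq, ?_,
    fun x s hs => hlip _ _ s (hsub' hs), hD₀, fun s hs => ?_, fun s hs => hDα s (hsub' hs)⟩
  · filter_upwards [eventually_forall_mem_of_lipschitz (fun x s hs => hlip x _ s (hsub' hs))
      (hcα.mono hsub') hV hmem] with x hx
    refine ⟨hα₀ x, fun s hs => ⟨hVU (hx s hs), ?_⟩⟩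
    rw [← hvV (hx s hs)]
    exact (hα x s (hsub' hs)).mono hsub'
  · have : fderiv ℝ (unitField B) (α (γ.curve s₀) s) = fderiv ℝ v (α (γ.curve s₀) s) := by
      refine Filter.EventuallyEq.fderiv_eq ?_
      filter_upwards [hV.mem_nhds (hmem s hs)] with y hy using (hvV hy).symm
    rw [this]
    exact (hD s (hsub' hs)).mono hsub'

namespace IsNearbyFamily

variable {γ : Segment U B} {s₀ a b C : ℝ} {α : Space → ℝ → Space} {D : ℝ → Space →L[ℝ] Space}

theorem Icc_subset (h : γ.IsNearbyFamily s₀ a b C α D) : Icc γ.left γ.right ⊆ Icc a b :=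
  Icc_subset_Icc h.lt_left.le h.right_lt.le

theorem continuousOn_centre (h : γ.IsNearbyFamily s₀ a b C α D) :
    ContinuousOn (α (γ.curve s₀)) (Icc a b) :=
  fun s hs => (h.fieldline.self_of_nhds.2 s hs).2.continuousWithinAt

theorem centre_mem (h : γ.IsNearbyFamily s₀ a b C α D) {s : ℝ} (hs : s ∈ Icc a b) :
    α (γ.curve s₀) s ∈ U := (h.fieldline.self_of_nhds.2 s hs).1

theorem hasDerivWithinAt_strength (hB : IsMagneticField U B)
    (h : γ.IsNearbyFamily s₀ a b C α D) : ∀ᶠ x in 𝓝 (γ.curve s₀), ∀ s ∈ Icc a b,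
      HasDerivWithinAt (fun t => ‖B (α x t)‖) (strengthDeriv B (α x s)) (Icc a b) s :=
  h.fieldline.mono fun _ hx s hs => hB.hasDerivWithinAt_strength (hx.2 s hs).1 (hx.2 s hs).2

/-- `C¹` functions of position are uniformly Lipschitz in the parameter of the family. -/
theorem exists_lipschitz_comp (hB : IsMagneticField U B) (h : γ.IsNearbyFamily s₀ a b C α D)
    {G : Space → ℝ} (hG : ∀ x ∈ U, ContDiffAt ℝ 1 G x) :
    ∃ C', 0 ≤ C' ∧ ∀ᶠ x in 𝓝 (γ.curve s₀), ∀ s ∈ Icc a b,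
      |G (α x s) - G (α (γ.curve s₀) s)| ≤ C' * ‖x - γ.curve s₀‖ := by
  obtain ⟨v, hv, hvc, V, hV, hSV, -, hvV⟩ := exists_compactlySupported_eqOn hB.isOpen
    (fun x hx => (hG x hx).contDiffWithinAt)
    (isCompact_Icc.image_of_continuousOn h.continuousOn_centre)
    (image_subset_iff.2 fun s hs => h.centre_mem hs)
  obtain ⟨K, hK⟩ := ContDiff.lipschitzWith_of_hasCompactSupport hvc hv one_ne_zero
  have hmem : ∀ s ∈ Icc a b, α (γ.curve s₀) s ∈ V := fun s hs => hSV (mem_image_of_mem _ hs)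
  refine ⟨K * |C|, by positivity, ?_⟩
  filter_upwards [eventually_forall_mem_of_lipschitz h.lipschitz h.continuousOn_centre hV hmem]
    with x hx s hs
  rw [← hvV (hx s hs), ← hvV (hmem s hs), ← Real.norm_eq_abs, mul_assoc]
  refine (hK.norm_sub_le _ _).trans (mul_le_mul_of_nonneg_left ?_ K.2)
  exact (h.lipschitz x s hs).trans (mul_le_mul_of_nonneg_right (le_abs_self C) (norm_nonneg _))

theorem eventually_abs_sub_lt (hB : IsMagneticField U B) (h : γ.IsNearbyFamily s₀ a b C α D)
    {G : Space → ℝ} (hG : ∀ x ∈ U, ContDiffAt ℝ 1 G x) {η : ℝ} (hη : 0 < η) :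
    ∀ᶠ x in 𝓝 (γ.curve s₀), ∀ s ∈ Icc a b, |G (α x s) - G (α (γ.curve s₀) s)| < η := by
  obtain ⟨C', -, hC'⟩ := h.exists_lipschitz_comp hB hG
  have hball : ∀ᶠ x in 𝓝 (γ.curve s₀), C' * ‖x - γ.curve s₀‖ < η := by
    have hc : Continuous fun x => C' * ‖x - γ.curve s₀‖ := by fun_prop
    have := hc.tendsto (γ.curve s₀)
    rw [sub_self, norm_zero, mul_zero] at this
    exact this.eventually_lt_const hη
  filter_upwards [hC', hball] with x hx hx' s hs
  exact (hx s hs).trans_lt hx'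

end IsNearbyFamily

end Segment

/-! ### The action of nearby fieldlines and its derivative -/

namespace Segment

variable {U : Set Space} {B : Space → Space}

/-- A nearby family that crosses the turning points transversally: the field strength decreases
until `l₁` and increases from `r₁` on. -/
structure IsTurningFamily (γ : Segment U B) (s₀ a b C l₁ r₁ c : ℝ) (α : Space → ℝ → Space)
    (D : ℝ → Space →L[ℝ] Space) : Prop extends γ.IsNearbyFamily s₀ a b C α D where
  pos : 0 < c
  left_lt : γ.left < l₁
  lt : l₁ < r₁
  lt_right : r₁ < γ.right
  decreasing : ∀ s ∈ Icc a l₁, strengthDeriv B (α (γ.curve s₀) s) < -(2 * c)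
  increasing : ∀ s ∈ Icc r₁ b, 2 * c < strengthDeriv B (α (γ.curve s₀) s)

theorem exists_isTurningFamily (hB : IsMagneticField U B) (γ : Segment U B) {s₀ : ℝ}
    (hs₀ : s₀ ∈ Icc γ.left γ.right) :
    ∃ a b C l₁ r₁ c α D, γ.IsTurningFamily s₀ a b C l₁ r₁ c α D := by
  obtain ⟨a, b, C, α, D, h⟩ := γ.exists_isNearbyFamily hB hs₀
  have hlr := γ.left_lt_right
  have hal := h.lt_left
  have hrb := h.right_lt
  have hL := γ.strengthDeriv_left_neg hB
  have hR := γ.strengthDeriv_right_pos hB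
  rw [← h.eq_curve _ γ.left_mem] at hL
  rw [← h.eq_curve _ γ.right_mem] at hR
  set k : ℝ → ℝ := fun s => strengthDeriv B (α (γ.curve s₀) s)
  have hk : ∀ s ∈ Icc γ.left γ.right, ContinuousAt k s := fun s hs =>
    ContinuousAt.comp (f := α (γ.curve s₀))
      (hB.contDiffAt_strengthDeriv (h.centre_mem (h.Icc_subset hs))).continuousAt
      (h.continuousOn_centre.continuousAt
        (Icc_mem_nhds (by linarith [hs.1]) (by linarith [hs.2])))
  have hc : 0 < min (-k γ.left) (k γ.right) := lt_min (by linarith) hR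
  -- At the ends `|B|'` has size at least `4 c`. Asking for `2 c` leaves room to extend to
  -- neighbourhoods of the ends, and then room `c` to perturb the fieldline.
  set c := min (-k γ.left) (k γ.right) / 4
  have hcl : k γ.left < -(2 * c) := by
    have := min_le_left (-k γ.left) (k γ.right)
    simp only [c]; linarith
  have hcr : 2 * c < k γ.right := by
    have := min_le_right (-k γ.left) (k γ.right)
    simp only [c]; linarith
  obtain ⟨δ₁, hδ₁, h₁⟩ := Metric.eventually_nhds_iff.1
    ((hk _ γ.left_mem).eventually_lt_const hcl)
  obtain ⟨δ₂, hδ₂, h₂⟩ := Metric.eventually_nhds_iff.1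
    ((hk _ γ.right_mem).eventually_const_lt hcr)
  obtain ⟨δ, hδ, hδlt⟩ := exists_between (lt_min (lt_min hδ₁ hδ₂) (lt_min (lt_min
    (sub_pos.2 hal) (sub_pos.2 hrb)) (by linarith : 0 < (γ.right - γ.left) / 2)))
  obtain ⟨⟨hδ1, hδ2⟩, ⟨hδ3, hδ4⟩, hδ5⟩ := by simpa only [lt_min_iff] using hδlt
  refine ⟨γ.left - δ, γ.right + δ, C, γ.left + δ, γ.right - δ, c, α, D,
    { h.shrink (by linarith) (by linarith) (by linarith) (by linarith) with
      pos := by positivity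
      left_lt := by linarith
      lt := by linarith
      lt_right := by linarith
      decreasing := fun s hs => h₁ ?_
      increasing := fun s hs => h₂ ?_ }⟩
  · rw [Real.dist_eq, abs_lt]
    constructor <;> linarith [hs.1, hs.2]
  · rw [Real.dist_eq, abs_lt]
    constructor <;> linarith [hs.1, hs.2]

/-- The action at level `p.2` of the fieldline through `p.1`. -/
noncomputable def familyAction (B : Space → Space) (α : Space → ℝ → Space) (a b : ℝ)
    (p : Space × ℝ) : ℝ :=
  ∫ s in a..b, √(2 * (p.2 - ‖B (α p.1 s)‖))

namespace IsTurningFamily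

variable {γ : Segment U B} {s₀ a b C l₁ r₁ c : ℝ} {α : Space → ℝ → Space}
  {D : ℝ → Space →L[ℝ] Space}

theorem lt_ends (h : γ.IsTurningFamily s₀ a b C l₁ r₁ c α D) : a < b := by
  linarith [h.lt_left, h.right_lt, γ.left_lt_right]

/-- The excess of the level over the field strength along the central fieldline grows linearly
away from the turning points. -/
theorem exists_linear_growth (hB : IsMagneticField U B)
    (h : γ.IsTurningFamily s₀ a b C l₁ r₁ c α D) :
    ∃ κ > 0, (∀ s ∈ Icc a b, κ * min |s - γ.left| |s - γ.right|
        ≤ |γ.level - ‖B (α (γ.curve s₀) s)‖|) ∧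
      (∀ s ∈ Icc l₁ r₁, κ ≤ γ.level - ‖B (α (γ.curve s₀) s)‖) ∧
      (∀ s ∈ Ico a γ.left, γ.level - ‖B (α (γ.curve s₀) s)‖ < 0) ∧
      ∀ s ∈ Ioc γ.right b, γ.level - ‖B (α (γ.curve s₀) s)‖ < 0 := by
  have hal := h.lt_left
  have hrb := h.right_lt
  have hl := h.left_lt
  have hlr := h.lt
  have hr := h.lt_right
  have hc := h.pos
  set q : ℝ → ℝ := fun s => γ.level - ‖B (α (γ.curve s₀) s)‖
  have hq : ∀ s ∈ Icc a b,
      HasDerivWithinAt q (-strengthDeriv B (α (γ.curve s₀) s)) (Icc a b) s := fun s hs =>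
    ((h.hasDerivWithinAt_strength hB).self_of_nhds s hs).const_sub γ.level
  have hsubl : Icc a l₁ ⊆ Icc a b := Icc_subset_Icc_right (by linarith)
  have hsubr : Icc r₁ b ⊆ Icc a b := Icc_subset_Icc_left (by linarith)
  have hsubm : Icc l₁ r₁ ⊆ Icc a b := Icc_subset_Icc (by linarith) (by linarith)
  have hq_left : q γ.left = 0 := by
    simp only [q, h.eq_curve _ γ.left_mem, γ.strength_left, sub_self]
  have hq_right : q γ.right = 0 := by
    simp only [q, h.eq_curve _ γ.right_mem, γ.strength_right, sub_self]
  have hml : γ.left ∈ Icc a l₁ := ⟨hal.le, hl.le⟩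
  have hmr : γ.right ∈ Icc r₁ b := ⟨hr.le, hrb.le⟩
  have hmono : StrictMonoOn q (Icc a l₁) := by
    refine strictMonoOn_of_hasDerivWithinAt_pos (convex_Icc a l₁)
      (fun s hs => ((hq s (hsubl hs)).continuousWithinAt.mono hsubl))
      (fun s hs => (hq s (hsubl (interior_subset hs))).mono (interior_subset.trans hsubl))
      (fun s hs => by linarith [h.decreasing s (interior_subset hs)])
  have hanti : StrictAntiOn q (Icc r₁ b) := by
    refine strictAntiOn_of_hasDerivWithinAt_neg (convex_Icc r₁ b)
      (fun s hs => ((hq s (hsubr hs)).continuousWithinAt.mono hsubr))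
      (fun s hs => (hq s (hsubr (interior_subset hs))).mono (interior_subset.trans hsubr))
      (fun s hs => by linarith [h.increasing s (interior_subset hs)])
  obtain ⟨t, ht, htmin⟩ := isCompact_Icc.exists_isMinOn (nonempty_Icc.2 hlr.le)
    (fun s hs => ((hq s (hsubm hs)).continuousWithinAt.mono hsubm) : ContinuousOn q (Icc l₁ r₁))
  have hqt : 0 < q t := by
    have ht' : t ∈ Ioo γ.left γ.right := ⟨hl.trans_le ht.1, ht.2.trans_lt hr⟩
    simp only [q, h.eq_curve _ (Ioo_subset_Icc_self ht')]
    linarith [γ.strength_lt t ht']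
  have hlen : 0 < b - a := sub_pos.2 h.lt_ends
  -- Near the ends the slope gives `c`. In the middle the excess is at least its minimum `q t`, and
  -- the distance to an end is at most `b - a`.
  refine ⟨min c (min (q t) (q t / (b - a))), by positivity, fun s hs => ?_, fun s hs => ?_,
    fun s hs => ?_, fun s hs => ?_⟩
  · have hm0 : 0 ≤ min |s - γ.left| |s - γ.right| := le_min (abs_nonneg _) (abs_nonneg _)
    rcases le_total s l₁ with h1 | h1
    · have := mul_abs_sub_le_abs_sub hc (fun s hs => (hq s (hsubl hs)).mono hsubl)
        (fun s hs => by linarith [h.decreasing s hs]) ⟨hs.1, h1⟩ hml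
      rw [hq_left, sub_zero] at this
      exact (mul_le_mul (min_le_left _ _) (min_le_left _ _) hm0 hc.le).trans this
    · rcases le_total s r₁ with h2 | h2
      · have hqs : q t ≤ q s := htmin ⟨h1, h2⟩
        refine le_trans ?_ (hqs.trans (le_abs_self (q s)))
        calc min c (min (q t) (q t / (b - a))) * min |s - γ.left| |s - γ.right|
            ≤ q t / (b - a) * (b - a) := by
              refine mul_le_mul ((min_le_right _ _).trans (min_le_right _ _))
                ((min_le_left _ _).trans ?_) hm0 (by positivity)
              rw [abs_le]
              constructor <;> linarith [hs.1, hs.2, γ.left_lt_right]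
          _ = q t := div_mul_cancel₀ _ hlen.ne'
      · have := mul_abs_sub_le_abs_sub (q := fun s => -q s) hc
          (fun s hs => ((hq s (hsubr hs)).mono hsubr).neg)
          (fun s hs => by linarith [h.increasing s hs]) ⟨h2, hs.2⟩ hmr
        rw [hq_right, neg_zero, sub_zero, abs_neg] at this
        exact (mul_le_mul (min_le_left _ _) (min_le_right _ _) hm0 hc.le).trans this
  · exact ((min_le_right _ _).trans (min_le_left _ _)).trans (htmin hs)
  · rw [← hq_left]
    exact hmono ⟨hs.1, by linarith [hs.2]⟩ hml hs.2
  · rw [← hq_right]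
    exact hanti hmr ⟨by linarith [hs.1], hs.2⟩ hs.1

/-- Near a segment, each fieldline carries a segment of each nearby level, and its label depends
on the fieldline only. -/
theorem eventually_exists_segment (hB : IsMagneticField U B)
    (h : γ.IsTurningFamily s₀ a b C l₁ r₁ c α D) (hs₀ : s₀ ∈ Icc γ.left γ.right) :
    ∀ᶠ p in 𝓝 (γ.curve s₀, γ.level), ∃ γ' : Segment U B, γ'.level = p.2 ∧
      γ'.wells = α p.1 '' Icc l₁ r₁ ∩ criticalSet U B ∧ γ'.action = familyAction B α a b p ∧
      (‖B p.1‖ ≤ p.2 → p.1 ∈ γ'.curve '' Icc γ'.left γ'.right) := by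
  have hal := h.lt_left
  have hrb := h.right_lt
  have hl := h.left_lt
  have hlr := h.lt
  have hr := h.lt_right
  have hc := h.pos
  obtain ⟨κ, hκ, -, hmid, hleft, hright⟩ := h.exists_linear_growth hB
  have ha := hleft a ⟨le_rfl, hal⟩
  have hb := hright b ⟨hrb, le_rfl⟩
  set q : ℝ → ℝ := fun s => γ.level - ‖B (α (γ.curve s₀) s)‖
  -- Any change of the excess below `η` keeps it negative at `a` and `b` and positive on the middle
  -- part. Half of `η` is allotted to the field strength, half to the level.
  obtain ⟨η, hη, hηlt⟩ := exists_between (lt_min hκ (lt_min (neg_pos.2 ha) (neg_pos.2 hb)))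
  obtain ⟨hη1, hη2, hη3⟩ := by simpa only [lt_min_iff] using hηlt
  have hfst : Tendsto Prod.fst (𝓝 (γ.curve s₀, γ.level)) (𝓝 (γ.curve s₀)) := continuousAt_fst
  have hsnd : Tendsto Prod.snd (𝓝 (γ.curve s₀, γ.level)) (𝓝 γ.level) := continuousAt_snd
  filter_upwards [hfst.eventually h.fieldline,
    hfst.eventually (h.hasDerivWithinAt_strength hB),
    hfst.eventually (h.eventually_abs_sub_lt hB (G := strengthDeriv B)
      (fun x hx => hB.contDiffAt_strengthDeriv hx) hc),
    hfst.eventually (h.eventually_abs_sub_lt hB (G := fun x => ‖B x‖)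
      (fun x hx => (hB.contDiffAt_strength hx).of_le (by norm_num)) (half_pos hη)),
    hsnd.eventually (Metric.ball_mem_nhds γ.level (half_pos hη))] with p hp hpd hpk hpB hpl
  obtain ⟨x, e⟩ := p
  rw [Real.dist_eq] at hpl
  simp only at *
  have hclose : ∀ s ∈ Icc a b, |(e - ‖B (α x s)‖) - q s| < η := by
    intro s hs
    have e1 := abs_lt.1 (hpB s hs)
    have e2 := abs_lt.1 hpl
    simp only [q]
    rw [abs_lt]
    constructor <;> linarith [e1.1, e1.2, e2.1, e2.2]
  have hma : a ∈ Icc a b := ⟨le_rfl, h.lt_ends.le⟩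
  have hmb : b ∈ Icc a b := ⟨h.lt_ends.le, le_rfl⟩
  obtain ⟨l, hl', r, hr', hl0, hr0, hpos, hnl, hnr⟩ := exists_zeros_of_single_well
    (q := fun s => e - ‖B (α x s)‖) (q' := fun s => -strengthDeriv B (α x s))
    (hal.trans hl) hlr (hr.trans hrb) (fun s hs => (hpd s hs).const_sub e)
    (fun s hs => by
      have := (abs_lt.1 (hpk s ⟨hs.1, by linarith [hs.2]⟩)).2
      linarith [h.decreasing s hs])
    (fun s hs => by
      have := (abs_lt.1 (hpk s ⟨by linarith [hs.1], hs.2⟩)).1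
      linarith [h.increasing s hs])
    (by linarith [(abs_lt.1 (hclose a hma)).2])
    (by linarith [(abs_lt.1 (hclose b hmb)).2])
    (fun s hs => by
      linarith [(abs_lt.1 (hclose s ⟨by linarith [hs.1], by linarith [hs.2]⟩)).1, hmid s hs])
  have hsub : Icc l r ⊆ Icc a b := Icc_subset_Icc hl'.1.le hr'.2.le
  have hkl : ∀ s ∈ Icc a l₁, strengthDeriv B (α x s) ≠ 0 := fun s hs => by
    have := (abs_lt.1 (hpk s ⟨hs.1, by linarith [hs.2]⟩)).2
    linarith [h.decreasing s hs]
  have hkr : ∀ s ∈ Icc r₁ b, strengthDeriv B (α x s) ≠ 0 := fun s hs => by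
    have := (abs_lt.1 (hpk s ⟨by linarith [hs.1], hs.2⟩)).1
    linarith [h.increasing s hs]
  refine ⟨{ curve := α x, left := l, right := r, level := e
            left_lt_right := by linarith [hl'.2, hr'.1]
            mem_domain := fun s hs => (hp.2 s (hsub hs)).1
            tangent := fun s hs => (hp.2 s (hsub hs)).2.mono hsub
            strength_lt := fun s hs => by linarith [hpos s hs]
            strength_left := by linarith
            strength_right := by linarith
            turning_left := hkl l ⟨hl'.1.le, hl'.2.le⟩
            turning_right := hkr r ⟨hr'.1.le, hr'.2.le⟩ }, rfl, ?_, ?_, fun hx => ?_⟩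
  -- The turning points move with the level, but only within the zones where `|B|' ≠ 0`; all
  -- critical points lie between `l₁` and `r₁`.
  · refine Subset.antisymm ?_ (inter_subset_inter_left _ (image_mono
      (Icc_subset_Icc hl'.2.le hr'.1.le)))
    rintro _ ⟨⟨s, hs, rfl⟩, hcrit⟩
    refine ⟨mem_image_of_mem _ ⟨?_, ?_⟩, hcrit⟩
    · by_contra! hlt
      exact hkl s ⟨(hsub hs).1, hlt.le⟩ hcrit.2
    · by_contra! hlt
      exact hkr s ⟨hlt.le, (hsub hs).2⟩ hcrit.2
  · have hcont : ContinuousOn (fun s => √(2 * (e - ‖B (α x s)‖))) (Icc a b) :=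
      (continuousOn_const.mul (continuousOn_const.sub
        fun s hs => (hpd s hs).continuousWithinAt)).sqrt
    have hint : ∀ u v, u ∈ Icc a b → v ∈ Icc a b →
        IntervalIntegrable (fun s => √(2 * (e - ‖B (α x s)‖))) volume u v := fun u v hu hv =>
      (hcont.mono (uIcc_subset_Icc hu hv)).intervalIntegrable
    have hlm : l ∈ Icc a b := ⟨hl'.1.le, by linarith [hl'.2]⟩
    have hrm : r ∈ Icc a b := ⟨by linarith [hr'.1], hr'.2.le⟩
    -- Beyond the turning points the radicand is nonpositive, so the integrand vanishes.
    have z1 : ∫ s in a..l, √(2 * (e - ‖B (α x s)‖)) = 0 := by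
      refine intervalIntegral.integral_zero_ae (Eventually.of_forall fun s hs => ?_)
      rw [uIoc_of_le hl'.1.le] at hs
      refine Real.sqrt_eq_zero_of_nonpos ?_
      rcases eq_or_lt_of_le hs.2 with he | he
      · rw [he]; linarith
      · linarith [hnl s ⟨hs.1.le, he⟩]
    have z2 : ∫ s in r..b, √(2 * (e - ‖B (α x s)‖)) = 0 := by
      refine intervalIntegral.integral_zero_ae (Eventually.of_forall fun s hs => ?_)
      rw [uIoc_of_le hr'.2.le] at hs
      exact Real.sqrt_eq_zero_of_nonpos (by linarith [hnr s hs])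
    have key : familyAction B α a b (x, e) = ∫ s in l..r, √(2 * (e - ‖B (α x s)‖)) := by
      rw [familyAction, ← intervalIntegral.integral_add_adjacent_intervals (hint a r hma hrm)
        (hint r b hrm hmb), ← intervalIntegral.integral_add_adjacent_intervals (hint a l hma hlm)
        (hint l r hlm hrm), z1, z2, zero_add, add_zero]
    exact key.symm
  -- Outside `[l, r]` the strength exceeds the level, which the assumption on `x` forbids at `s₀`.
  · have hs₀' : s₀ ∈ Icc a b := h.Icc_subset hs₀
    refine ⟨s₀, ⟨?_, ?_⟩, hp.1⟩
    · by_contra! hlt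
      have := hnl s₀ ⟨hs₀'.1, hlt⟩
      rw [hp.1] at this
      linarith
    · by_contra! hlt
      have := hnr s₀ ⟨hlt, hs₀'.2⟩
      rw [hp.1] at this
      linarith

/-- The action is continuous in the level. -/
theorem continuous_familyAction (hB : IsMagneticField U B)
    (h : γ.IsTurningFamily s₀ a b C l₁ r₁ c α D) :
    ∀ᶠ x in 𝓝 (γ.curve s₀), Continuous fun e => familyAction B α a b (x, e) := by
  filter_upwards [h.hasDerivWithinAt_strength hB] with x hx
  have hcont : ContinuousOn (fun s => ‖B (α x s)‖) (Icc a b) :=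
    fun s hs => (hx s hs).continuousWithinAt
  refine continuous_iff_continuousAt.2 fun e => ?_
  refine intervalIntegral.continuousAt_of_dominated_interval
    (bound := fun _ => √(2 * (e + 1))) ?_ ?_ intervalIntegrable_const ?_
  · refine Eventually.of_forall fun e' => ?_
    rw [uIoc_of_le h.lt_ends.le]
    exact ((continuousOn_const.mul (continuousOn_const.sub hcont)).sqrt.mono
      Ioc_subset_Icc_self).aestronglyMeasurable measurableSet_Ioc
  · filter_upwards [Iio_mem_nhds (lt_add_one e)] with e' he'
    refine Eventually.of_forall fun s _ => ?_
    rw [Real.norm_of_nonneg (Real.sqrt_nonneg _)]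
    refine Real.sqrt_le_sqrt ?_
    linarith [norm_nonneg (B (α x s)), mem_Iio.1 he']
  · exact Eventually.of_forall fun s _ =>
      (continuous_const.mul (continuous_id.sub continuous_const)).sqrt.continuousAt

/-- The derivative of the action with respect to the fieldline and the level. -/
theorem hasFDerivAt_familyAction (hB : IsMagneticField U B)
    (h : γ.IsTurningFamily s₀ a b C l₁ r₁ c α D) :
    IntervalIntegrable (fun s => (γ.speed s)⁻¹) volume γ.left γ.right ∧
    IntervalIntegrable (fun s => (γ.speed s)⁻¹ •
      (innerSL ℝ (gradStrength B (γ.curve s))).comp (D s)) volume γ.left γ.right ∧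
    HasFDerivAt (familyAction B α a b)
      ((-∫ s in γ.left..γ.right, (γ.speed s)⁻¹ •
          (innerSL ℝ (gradStrength B (γ.curve s))).comp (D s)).comp
          (ContinuousLinearMap.fst ℝ Space ℝ)
        + (∫ s in γ.left..γ.right, (γ.speed s)⁻¹) • ContinuousLinearMap.snd ℝ Space ℝ)
      (γ.curve s₀, γ.level) := by
  obtain ⟨κ, hκ, hgrow, -, hleft, hright⟩ := h.exists_linear_growth hB
  obtain ⟨C', hC', hlip⟩ := h.exists_lipschitz_comp hB (G := fun x => ‖B x‖)
    (fun x hx => (hB.contDiffAt_strength hx).of_le (by norm_num))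
  have hfst : Tendsto Prod.fst (𝓝 (γ.curve s₀, γ.level)) (𝓝 (γ.curve s₀)) := continuousAt_fst
  set A : ℝ → Space →L[ℝ] ℝ := fun s =>
    (innerSL ℝ (gradStrength B (α (γ.curve s₀) s))).comp (D s)
  have hA : ContinuousOn A (Icc a b) := by
    have hD : ContinuousOn D (Icc a b) := fun s hs => (h.variation s hs).continuousWithinAt
    refine ContinuousOn.clm_comp ((innerSL ℝ).continuous.comp_continuousOn fun s hs => ?_) hD
    exact (hB.contDiffAt_gradStrength (h.centre_mem hs)).continuousAt.comp_continuousWithinAt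
      (h.continuousOn_centre s hs)
  obtain ⟨hint, hder⟩ := hasFDerivAt_integral_sqrt (p₀ := (γ.curve s₀, γ.level))
    (f := fun p s => p.2 - ‖B (α p.1 s)‖)
    (f' := fun s => ContinuousLinearMap.snd ℝ Space ℝ -
      (A s).comp (ContinuousLinearMap.fst ℝ Space ℝ)) (C := 1 + C')
    h.lt_ends.le hκ
    (by
      filter_upwards [hfst.eventually (h.hasDerivWithinAt_strength hB)] with p hp
      exact continuousOn_const.sub fun s hs => (hp s hs).continuousWithinAt)
    (by
      filter_upwards [hfst.eventually hlip] with p hp s hs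
      have e1 : |p.2 - γ.level| ≤ ‖p - (γ.curve s₀, γ.level)‖ := norm_snd_le (p - (_, _))
      have e2 : ‖p.1 - γ.curve s₀‖ ≤ ‖p - (γ.curve s₀, γ.level)‖ := norm_fst_le (p - (_, _))
      have e3 : p.2 - ‖B (α p.1 s)‖ - (γ.level - ‖B (α (γ.curve s₀) s)‖)
          = (p.2 - γ.level) - (‖B (α p.1 s)‖ - ‖B (α (γ.curve s₀) s)‖) := by ring
      rw [e3, add_mul, one_mul]
      refine (abs_sub _ _).trans (add_le_add e1 ((hp s hs).trans ?_))
      exact mul_le_mul_of_nonneg_left e2 hC')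
    (fun s hs => by
      refine (hasFDerivAt_snd (𝕜 := ℝ) (E := Space) (F := ℝ)).sub ?_
      have e1 : HasFDerivAt (fun x => ‖B (α x s)‖) (A s) (γ.curve s₀) :=
        HasFDerivAt.comp (f := fun x => α x s) (γ.curve s₀)
          (hB.hasFDerivAt_strength (h.centre_mem hs)) (h.hasFDerivAt s hs)
      exact HasFDerivAt.comp (f := Prod.fst) (γ.curve s₀, γ.level) e1
        (hasFDerivAt_fst (𝕜 := ℝ) (E := Space) (F := ℝ)))
    (continuousOn_const.sub (hA.clm_comp continuousOn_const)) hgrow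
  have hma : a ∈ Icc a b := ⟨le_rfl, h.lt_ends.le⟩
  have hmb : b ∈ Icc a b := ⟨h.lt_ends.le, le_rfl⟩
  have hml := h.Icc_subset γ.left_mem
  have hmr := h.Icc_subset γ.right_mem
  have hinv : IntervalIntegrable (fun s => (γ.speed s)⁻¹) volume γ.left γ.right := by
    have := intervalIntegrable_inv_sqrt_of_linear_growth (c := 2 * κ)
      (q := fun s => 2 * (γ.level - ‖B (γ.curve s)‖)) (l := γ.left) (r := γ.right)
      γ.left_lt_right.le (by positivity)
      (continuousOn_const.mul (continuousOn_const.sub (γ.continuousOn_strength hB)))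
      (fun s hs => by
        rw [abs_mul, abs_two, mul_assoc, ← h.eq_curve s hs]
        exact mul_le_mul_of_nonneg_left (hgrow s (h.Icc_subset hs)) two_pos.le)
    refine this.congr fun s hs => ?_
    rw [uIoc_of_le γ.left_lt_right.le] at hs
    have := γ.strength_le (Ioc_subset_Icc_self hs)
    simp only [speed]
    rw [abs_of_nonneg (by linarith)]
  have hA' : ContinuousOn (fun s => (innerSL ℝ (gradStrength B (γ.curve s))).comp (D s))
      (Icc γ.left γ.right) :=
    (hA.mono h.Icc_subset).congr fun s hs => by simp only [A, h.eq_curve s hs]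
  have hint' := hinv.smul_continuousOn (by rwa [uIcc_of_le γ.left_lt_right.le])
  refine ⟨hinv, hint', ?_⟩
  set G : ℝ → Space × ℝ →L[ℝ] ℝ := fun s => (√(2 * (γ.level - ‖B (α (γ.curve s₀) s)‖)))⁻¹ •
    (ContinuousLinearMap.snd ℝ Space ℝ - (A s).comp (ContinuousLinearMap.fst ℝ Space ℝ))
  have hmono : ∀ u v, u ∈ Icc a b → v ∈ Icc a b → IntervalIntegrable G volume u v :=
    fun u v hu hv => hint.mono_set (by
      rw [uIcc_of_le h.lt_ends.le]
      exact uIcc_subset_Icc hu hv)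
  -- Beyond the ends of `γ` the factor is `0⁻¹ = 0`, so the derivative is an integral over `γ`
  -- alone; no boundary terms arise from the moving turning points.
  have hG0 : ∀ s, γ.level - ‖B (α (γ.curve s₀) s)‖ ≤ 0 → G s = 0 := fun s hs => by
    simp only [G]
    rw [Real.sqrt_eq_zero_of_nonpos (by linarith), inv_zero, zero_smul]
  have z1 : ∫ s in a..γ.left, G s = 0 := by
    refine intervalIntegral.integral_zero_ae (Eventually.of_forall fun s hs => hG0 s ?_)
    rw [uIoc_of_le h.lt_left.le] at hs
    rcases eq_or_lt_of_le hs.2 with he | he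
    · rw [he, h.eq_curve _ γ.left_mem, γ.strength_left, sub_self]
    · exact (hleft s ⟨hs.1.le, he⟩).le
  have z2 : ∫ s in γ.right..b, G s = 0 := by
    refine intervalIntegral.integral_zero_ae (Eventually.of_forall fun s hs => hG0 s ?_)
    rw [uIoc_of_le h.right_lt.le] at hs
    exact (hright s hs).le
  have hGγ : ∫ s in γ.left..γ.right, G s = ∫ s in γ.left..γ.right,
      ((γ.speed s)⁻¹ • ContinuousLinearMap.snd ℝ Space ℝ -
        ((γ.speed s)⁻¹ • (innerSL ℝ (gradStrength B (γ.curve s))).comp (D s)).comp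
          (ContinuousLinearMap.fst ℝ Space ℝ)) := by
    refine intervalIntegral.integral_congr fun s hs => ?_
    rw [uIcc_of_le γ.left_lt_right.le] at hs
    simp only [G, A, speed, h.eq_curve s hs, smul_sub, ContinuousLinearMap.smul_comp]
  have htotal : ∫ s in a..b, G s = ∫ s in γ.left..γ.right, G s := by
    rw [← intervalIntegral.integral_add_adjacent_intervals (hmono a _ hma hmr)
      (hmono _ b hmr hmb), ← intervalIntegral.integral_add_adjacent_intervals
      (hmono a _ hma hml) (hmono _ _ hml hmr), z1, z2, zero_add, add_zero]
  let R : (Space →L[ℝ] ℝ) →L[ℝ] Space × ℝ →L[ℝ] ℝ :=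
    (ContinuousLinearMap.compL ℝ (Space × ℝ) Space ℝ).flip (ContinuousLinearMap.fst ℝ Space ℝ)
  have hR := R.intervalIntegral_comp_comm hint'
  have hRint : IntervalIntegrable (fun s =>
      R ((γ.speed s)⁻¹ • (innerSL ℝ (gradStrength B (γ.curve s))).comp (D s))) volume
      γ.left γ.right := ⟨R.integrable_comp hint'.1, R.integrable_comp hint'.2⟩
  have hsnd := hinv.smul_continuousOn
    (continuousOn_const (c := ContinuousLinearMap.snd ℝ Space ℝ) (s := uIcc γ.left γ.right))
  have hsub := intervalIntegral.integral_sub hsnd hRint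
  rw [intervalIntegral.integral_smul_const, hR] at hsub
  convert! hder using 1
  rw [ContinuousLinearMap.neg_comp, neg_add_eq_sub]
  exact (hsub.symm.trans hGγ.symm).trans htotal.symm

end IsTurningFamily

end Segment

/-! ### Commuting fields along the bounce orbit and the variation of the action -/

/-- A nonnegative function whose logarithmic derivative is bounded vanishes identically if it
vanishes at one point, even if it is differentiable only in the interior of the interval. -/
theorem eq_zero_of_abs_deriv_le {q q' : ℝ → ℝ} {K l r t : ℝ} (ht : t ∈ Icc l r)
    (hc : ContinuousOn q (Icc l r)) (hq : ∀ s ∈ Ioo l r, HasDerivAt q (q' s) s)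
    (hb : ∀ s ∈ Ioo l r, |q' s| ≤ K * q s) (hnn : ∀ s, 0 ≤ q s) (h0 : q t = 0) :
    ∀ s ∈ Icc l r, q s = 0 := by
  have hexp : ∀ κ s : ℝ, HasDerivAt (fun s => Real.exp (κ * s)) (Real.exp (κ * s) * κ) s :=
    fun κ s => by simpa using ((hasDerivAt_id s).const_mul κ).exp
  intro s hs
  rcases le_total t s with h | h
  · have hsub : Icc t r ⊆ Icc l r := Icc_subset_Icc_left ht.1
    have hanti : AntitoneOn (fun s => Real.exp (-K * s) * q s) (Icc t r) := by
      refine antitoneOn_of_hasDerivWithinAt_nonpos (convex_Icc t r)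
        (f' := fun s => Real.exp (-K * s) * -K * q s + Real.exp (-K * s) * q' s)
        (ContinuousOn.mul (by fun_prop) (hc.mono hsub)) (fun s hs => ?_) (fun s hs => ?_)
      · rw [interior_Icc] at hs
        exact ((hexp (-K) s).mul (hq s ⟨ht.1.trans_lt hs.1, hs.2⟩)).hasDerivWithinAt
      · rw [interior_Icc] at hs
        have := (abs_le.1 (hb s ⟨ht.1.trans_lt hs.1, hs.2⟩)).2
        have e := mul_le_mul_of_nonneg_left this (Real.exp_pos (-K * s)).le
        linarith
    have := hanti ⟨le_rfl, ht.2⟩ ⟨h, hs.2⟩ h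
    simp only [h0, mul_zero] at this
    exact le_antisymm (nonpos_of_mul_nonpos_right this (Real.exp_pos _)) (hnn s)
  · have hsub : Icc l t ⊆ Icc l r := Icc_subset_Icc_right ht.2
    have hmono : MonotoneOn (fun s => Real.exp (K * s) * q s) (Icc l t) := by
      refine monotoneOn_of_hasDerivWithinAt_nonneg (convex_Icc l t)
        (f' := fun s => Real.exp (K * s) * K * q s + Real.exp (K * s) * q' s)
        (ContinuousOn.mul (by fun_prop) (hc.mono hsub)) (fun s hs => ?_) (fun s hs => ?_)
      · rw [interior_Icc] at hs
        exact ((hexp K s).mul (hq s ⟨hs.1, hs.2.trans_le ht.2⟩)).hasDerivWithinAt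
      · rw [interior_Icc] at hs
        have := (abs_le.1 (hb s ⟨hs.1, hs.2.trans_le ht.2⟩)).1
        have e := mul_le_mul_of_nonneg_left this (Real.exp_pos (K * s)).le
        linarith
    have := hmono ⟨hs.1, h⟩ ⟨ht.1, le_rfl⟩ h
    simp only [h0, mul_zero] at this
    exact le_antisymm (nonpos_of_mul_nonpos_right this (Real.exp_pos _)) (hnn s)

theorem perp_sub (B : Space → Space) (x u w : Space) :
    perp B x (u - w) = perp B x u - perp B x w := by
  simp only [perp, inner_sub_left, sub_smul]
  abel

namespace Segment

variable {U : Set Space} {B : Space → Space}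

theorem continuousOn_comp_curve (γ : Segment U B) {F : Type*} [TopologicalSpace F] {G : Space → F}
    (hG : ∀ x ∈ U, ContinuousAt G x) :
    ContinuousOn (fun s => G (γ.curve s)) (Icc γ.left γ.right) := fun s hs =>
  (hG _ (γ.mem_domain s hs)).comp_continuousWithinAt (γ.continuousOn_curve s hs)

theorem continuousOn_unitField (hB : IsMagneticField U B) (γ : Segment U B) :
    ContinuousOn (fun s => unitField B (γ.curve s)) (Icc γ.left γ.right) :=
  γ.continuousOn_comp_curve fun _ hx => (hB.contDiffAt_unitField hx).continuousAt

theorem continuousOn_fderiv_unitField (hB : IsMagneticField U B) (γ : Segment U B) :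
    ContinuousOn (fun s => fderiv ℝ (unitField B) (γ.curve s)) (Icc γ.left γ.right) :=
  γ.continuousOn_comp_curve fun _ hx =>
    ((hB.contDiffAt_unitField hx).fderiv_right (m := 1) (by norm_num)).continuousAt

theorem hasDerivAt_curve (γ : Segment U B) {s : ℝ} (hs : s ∈ Ioo γ.left γ.right) :
    HasDerivAt γ.curve (unitField B (γ.curve s)) s :=
  (γ.tangent s (Ioo_subset_Icc_self hs)).hasDerivAt (Icc_mem_nhds hs.1 hs.2)

theorem hasDerivAt_unitField (hB : IsMagneticField U B) (γ : Segment U B) {s : ℝ}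
    (hs : s ∈ Ioo γ.left γ.right) : HasDerivAt (fun t => unitField B (γ.curve t))
      (fderiv ℝ (unitField B) (γ.curve s) (unitField B (γ.curve s))) s :=
  (hB.hasFDerivAt_unitField (γ.mem_domain s (Ioo_subset_Icc_self hs))).comp_hasDerivAt s
    (γ.hasDerivAt_curve hs)

/-- A solution along a segment of the equation of variation of the fieldlines, up to a multiple
of the field direction, is parallel to the field everywhere if it is so at one point. -/
theorem perp_eq_zero_of_variation (hB : IsMagneticField U B) (γ : Segment U B) {e : ℝ → Space}
    {β : ℝ → ℝ} (hc : ContinuousOn e (Icc γ.left γ.right))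
    (he : ∀ s ∈ Ioo γ.left γ.right, HasDerivAt e
      (fderiv ℝ (unitField B) (γ.curve s) (e s) + β s • unitField B (γ.curve s)) s)
    {t : ℝ} (ht : t ∈ Icc γ.left γ.right) (h0 : perp B (γ.curve t) (e t) = 0) :
    ∀ s ∈ Icc γ.left γ.right, perp B (γ.curve s) (e s) = 0 := by
  have hb := γ.continuousOn_unitField hB
  obtain ⟨K, hK⟩ := isCompact_Icc.exists_bound_of_continuousOn (γ.continuousOn_fderiv_unitField hB)
  set Δ : ℝ → Space := fun s => perp B (γ.curve s) (e s)
  have hΔc : ContinuousOn Δ (Icc γ.left γ.right) := hc.sub ((hc.inner (𝕜 := ℝ) hb).smul hb)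
  -- Projecting changes the equation by a multiple of `b` only. Its coefficient is irrelevant, since
  -- `Δ` is perpendicular to `b` and the term drops out of the derivative of `‖Δ‖ ^ 2`.
  have hΔ : ∀ s ∈ Ioo γ.left γ.right, ∃ k : ℝ, HasDerivAt Δ
      (fderiv ℝ (unitField B) (γ.curve s) (Δ s) + k • unitField B (γ.curve s)) s := by
    intro s hs
    have h1 := γ.hasDerivAt_unitField hB hs
    refine ⟨β s - (inner ℝ (e s)
        (fderiv ℝ (unitField B) (γ.curve s) (unitField B (γ.curve s)))
        + inner ℝ (fderiv ℝ (unitField B) (γ.curve s) (e s) + β s • unitField B (γ.curve s))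
          (unitField B (γ.curve s))),
      ((he s hs).sub (((he s hs).inner ℝ h1).smul h1)).congr_deriv ?_⟩
    simp only [Δ, perp, map_sub, map_smul]
    module
  choose! k hk using hΔ
  have := eq_zero_of_abs_deriv_le (q := fun s => ‖Δ s‖ ^ 2)
    (q' := fun s => 2 * inner ℝ (Δ s)
      (fderiv ℝ (unitField B) (γ.curve s) (Δ s) + k s • unitField B (γ.curve s)))
    (K := 2 * K) ht (hΔc.norm.pow 2) (fun s hs => (hk s hs).norm_sq) (fun s hs => by
      have hs' := Ioo_subset_Icc_self hs
      have : inner ℝ (Δ s) (unitField B (γ.curve s)) = (0 : ℝ) :=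
        hB.inner_perp_unitField (γ.mem_domain s hs') _
      rw [inner_add_right, real_inner_smul_right, this, mul_zero, add_zero, abs_mul, abs_two,
        mul_assoc, pow_two]
      refine mul_le_mul_of_nonneg_left ((abs_real_inner_le_norm _ _).trans ?_) two_pos.le
      rw [mul_left_comm]
      refine mul_le_mul_of_nonneg_left (((fderiv ℝ (unitField B) (γ.curve s)).le_opNorm _).trans
        (mul_le_mul_of_nonneg_right (hK s hs') (norm_nonneg _))) (norm_nonneg _))
    (fun s => by positivity) (by simp [Δ, h0])
  intro s hs
  simpa [Δ] using this s hs

section Branches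

variable {m μ : ℝ}

/-- The point of arc length `s` on the branch of sign `σ` of the bounce orbit. -/
noncomputable def branch (m μ : ℝ) (γ : Segment U B) (σ s : ℝ) : Phase :=
  (γ.curve s, σ * γ.parallelSpeed m μ s)

theorem parallelSpeed_sq (hm : 0 < m) (hμ : 0 < μ) (γ : Segment U B) {s : ℝ}
    (hs : s ∈ Icc γ.left γ.right) :
    γ.parallelSpeed m μ s ^ 2 = 2 / m * (μ * γ.level - μ * ‖B (γ.curve s)‖) := by
  refine Real.sq_sqrt (mul_nonneg (by positivity) ?_)
  nlinarith [γ.strength_le hs]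

theorem parallelSpeed_eq (hμ : 0 < μ) (hm : 0 < m) (γ : Segment U B) (s : ℝ) :
    γ.parallelSpeed m μ s = √(μ / m) * γ.speed s := by
  rw [parallelSpeed, speed, ← Real.sqrt_mul (by positivity)]
  congr 1
  ring

theorem carries_branch (hm : 0 < m) (hμ : 0 < μ) (γ : Segment U B) {σ s : ℝ}
    (hσ : σ = 1 ∨ σ = -1) (hs : s ∈ Icc γ.left γ.right) : γ.Carries m μ (γ.branch m μ σ s) := by
  refine ⟨mem_image_of_mem _ hs, ?_⟩
  have hσ2 : σ ^ 2 = 1 := by rcases hσ with rfl | rfl <;> norm_num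
  simp only [scaledEnergy, branch, mul_pow, hσ2, one_mul, γ.parallelSpeed_sq hm hμ hs]
  field_simp
  ring

theorem exists_branch_eq (hm : 0 < m) (hμ : 0 < μ) (γ : Segment U B) {z : Phase}
    (hz : γ.Carries m μ z) : ∃ σ s, (σ = 1 ∨ σ = -1) ∧ s ∈ Icc γ.left γ.right ∧
      γ.branch m μ σ s = z := by
  obtain ⟨⟨s, hs, hsz⟩, he⟩ := hz
  have hsq : z.2 ^ 2 = γ.parallelSpeed m μ s ^ 2 := by
    rw [γ.parallelSpeed_sq hm hμ hs, hsz, ← he, scaledEnergy]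
    field_simp
    ring
  rcases sq_eq_sq_iff_eq_or_eq_neg.1 hsq with h | h
  · exact ⟨1, s, Or.inl rfl, hs, Prod.ext hsz (by simp [branch, h])⟩
  · exact ⟨-1, s, Or.inr rfl, hs, Prod.ext hsz (by simp [branch, h])⟩

theorem continuousOn_branch (hB : IsMagneticField U B) (γ : Segment U B) (σ : ℝ) :
    ContinuousOn (γ.branch m μ σ) (Icc γ.left γ.right) :=
  γ.continuousOn_curve.prodMk (continuousOn_const.mul (continuousOn_const.mul
    (continuousOn_const.sub (continuousOn_const.mul (γ.continuousOn_strength hB)))).sqrt)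

/-- Along each branch of the bounce orbit, arc length is a parameter of zeroth-order motion. -/
theorem hasDerivAt_branch (hm : 0 < m) (hμ : 0 < μ) (hB : IsMagneticField U B) (γ : Segment U B)
    {σ s : ℝ} (hσ : σ = 1 ∨ σ = -1) (hs : s ∈ Ioo γ.left γ.right) :
    0 < γ.parallelSpeed m μ s ∧ HasDerivAt (γ.branch m μ σ)
      ((σ * γ.parallelSpeed m μ s)⁻¹ • zgcField m μ B (γ.branch m μ σ s)) s := by
  have hpos : 0 < γ.parallelSpeed m μ s := by
    rw [γ.parallelSpeed_eq hμ hm]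
    exact mul_pos (Real.sqrt_pos.2 (by positivity)) (γ.speed_pos hs)
  refine ⟨hpos, ?_⟩
  have hσ0 : σ ≠ 0 := by rcases hσ with rfl | rfl <;> norm_num
  have hσ2 : σ * σ = 1 := by rcases hσ with rfl | rfl <;> norm_num
  have hB' := (γ.hasDerivWithinAt_strength hB (Ioo_subset_Icc_self hs)).hasDerivAt
    (Icc_mem_nhds hs.1 hs.2)
  have h1 := (((hB'.const_mul μ).const_sub (μ * γ.level)).const_mul (2 / m)).sqrt
    (ne_of_gt (Real.sqrt_pos.1 hpos))
  refine ((γ.hasDerivAt_curve hs).prodMk (h1.const_mul σ)).congr_deriv ?_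
  have e : √(2 / m * (μ * γ.level - μ * ‖B (γ.curve s)‖)) = γ.parallelSpeed m μ s := rfl
  rw [e]
  refine Prod.ext ?_ ?_
  · simp only [branch, zgcField, Prod.smul_mk, smul_smul]
    rw [inv_mul_cancel₀ (mul_ne_zero hσ0 hpos.ne'), one_smul]
  · simp only [branch, zgcField, Prod.smul_mk, smul_eq_mul]
    rw [mul_inv, inv_eq_of_mul_eq_one_right hσ2]
    field_simp

theorem parallelSpeed_left (γ : Segment U B) : γ.parallelSpeed m μ γ.left = 0 := by
  simp [parallelSpeed, γ.strength_left]

/-- A vector field that commutes with zeroth-order motion has, on both branches of a bounce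
orbit, the same perpendicular components as the variation of fieldlines that it induces at one
point of the orbit. -/
theorem perp_eq_of_commute (hm : 0 < m) (hμ : 0 < μ) (hB : IsMagneticField U B) {W : Set Phase}
    (hW : IsOpen W) (hWU : W ⊆ U ×ˢ univ) {X : Phase → Phase} (hX : ContDiffOn ℝ 1 X W)
    (hcomm : FlowsCommuteOn X (zgcField m μ B) W) (γ : Segment U B)
    (hγ : ∀ w, γ.Carries m μ w → w ∈ W) {Y : ℝ → Space}
    (hY : ∀ s ∈ Icc γ.left γ.right, HasDerivWithinAt Y
      (fderiv ℝ (unitField B) (γ.curve s) (Y s)) (Icc γ.left γ.right) s)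
    {σ₀ s₀ : ℝ} (hσ₀ : σ₀ = 1 ∨ σ₀ = -1) (hs₀ : s₀ ∈ Icc γ.left γ.right)
    (hY₀ : Y s₀ = (X (γ.branch m μ σ₀ s₀)).1) {σ s : ℝ} (hσ : σ = 1 ∨ σ = -1)
    (hs : s ∈ Icc γ.left γ.right) :
    perp B (γ.curve s) (X (γ.branch m μ σ s)).1 = perp B (γ.curve s) (Y s) := by
  have hmem : ∀ {σ s : ℝ}, (σ = 1 ∨ σ = -1) → s ∈ Icc γ.left γ.right → γ.branch m μ σ s ∈ W :=
    fun hσ hs => hγ _ (γ.carries_branch hm hμ hσ hs)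
  have key : ∀ {σ t : ℝ}, (σ = 1 ∨ σ = -1) → t ∈ Icc γ.left γ.right →
      perp B (γ.curve t) ((X (γ.branch m μ σ t)).1 - Y t) = 0 →
      ∀ s ∈ Icc γ.left γ.right, perp B (γ.curve s) ((X (γ.branch m μ σ s)).1 - Y s) = 0 := by
    intro σ t hσ ht h0
    have hσ0 : σ ≠ 0 := by rcases hσ with rfl | rfl <;> norm_num
    -- The coefficient `β` is the parallel-velocity component of `X` over `v_∥`. It may blow up at
    -- the turning points, which is harmless: only continuity is needed there.
    refine γ.perp_eq_zero_of_variation hB (e := fun s => (X (γ.branch m μ σ s)).1 - Y s)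
      (β := fun s => (σ * γ.parallelSpeed m μ s)⁻¹ * (X (γ.branch m μ σ s)).2) ?_
      (fun s hs => ?_) ht h0
    · refine ContinuousOn.sub (continuous_fst.comp_continuousOn (hX.continuousOn.comp
        (γ.continuousOn_branch hB σ) fun s hs => hmem hσ hs)) fun s hs =>
          (hY s hs).continuousWithinAt
    · have hs' := Ioo_subset_Icc_self hs
      have hw := hmem hσ hs'
      have hXw := hX.contDiffAt (hW.mem_nhds hw)
      obtain ⟨hpos, hd⟩ := γ.hasDerivAt_branch hm hμ hB hσ hs
      have h1 := (hXw.differentiableAt one_ne_zero).hasFDerivAt.comp_hasDerivAt s hd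
      -- The vanishing bracket turns the derivative of `X` along the motion into the linearised
      -- motion applied to `X`.
      rw [map_smul, hcomm.fderiv_apply_comm hw hXw (hB.contDiffAt_zgcField m μ (hWU hw).1)] at h1
      have h2 := (ContinuousLinearMap.fst ℝ Space ℝ).hasFDerivAt.comp_hasDerivAt s h1
      refine (h2.sub ((hY s hs').hasDerivAt (Icc_mem_nhds hs.1 hs.2))).congr_deriv ?_
      rw [map_smul, ContinuousLinearMap.coe_fst', hB.fderiv_zgcField_fst m μ (hWU hw).1]
      simp only [branch, map_sub, smul_add, smul_smul]
      rw [inv_mul_cancel₀ (mul_ne_zero hσ0 hpos.ne'), one_smul]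
      abel
  have hleft := key hσ₀ hs₀ (by simp [hY₀, perp]) γ.left γ.left_mem
  -- The two branches meet at the turning point, which passes the equality from one to the other.
  have hbr : γ.branch m μ σ₀ γ.left = γ.branch m μ σ γ.left := by
    simp [branch, γ.parallelSpeed_left]
  rw [hbr] at hleft
  have := key hσ γ.left_mem hleft s hs
  rwa [perp_sub, sub_eq_zero] at this

end Branches

/-- The first variation of the action along a variation `Y` of the fieldline. -/
theorem integral_variation_eq (hB : IsMagneticField U B) (γ : Segment U B)
    (hinv : IntervalIntegrable (fun s => (γ.speed s)⁻¹) volume γ.left γ.right) {Y : ℝ → Space}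
    (hY : ∀ s ∈ Icc γ.left γ.right, HasDerivWithinAt Y
      (fderiv ℝ (unitField B) (γ.curve s) (Y s)) (Icc γ.left γ.right) s)
    {m μ σ : ℝ} {X : Phase → Phase} (hX : ∀ s ∈ Icc γ.left γ.right,
      perp B (γ.curve s) (X (γ.branch m μ σ s)).1 = perp B (γ.curve s) (Y s)) :
    IntervalIntegrable (γ.onTangent (γ.derivForm m μ X σ)) volume γ.left γ.right ∧
    γ.integral (γ.derivForm m μ X σ)
      = ∫ s in γ.left..γ.right, (γ.speed s)⁻¹ * inner ℝ (gradStrength B (γ.curve s)) (Y s) := by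
  have hle := γ.left_lt_right.le
  have hb := γ.continuousOn_unitField hB
  have hDb := γ.continuousOn_fderiv_unitField hB
  have hYc : ContinuousOn Y (Icc γ.left γ.right) := fun s hs => (hY s hs).continuousWithinAt
  have hg : ContinuousOn (fun s => gradStrength B (γ.curve s)) (Icc γ.left γ.right) :=
    γ.continuousOn_comp_curve fun _ hx => (hB.contDiffAt_gradStrength hx).continuousAt
  have hk : ContinuousOn (fun s => strengthDeriv B (γ.curve s)) (Icc γ.left γ.right) :=
    γ.continuousOn_comp_curve fun _ hx => (hB.contDiffAt_strengthDeriv hx).continuousAt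
  have hv := γ.continuousOn_speed hB
  -- The derivative of `speed * (Y · b)`, a function that vanishes at both ends because the speed
  -- does.
  set ρ' : ℝ → ℝ := fun s =>
    (γ.speed s)⁻¹ * (-strengthDeriv B (γ.curve s) * inner ℝ (Y s) (unitField B (γ.curve s)))
      + γ.speed s * inner ℝ (Y s)
        (fderiv ℝ (unitField B) (γ.curve s) (unitField B (γ.curve s)))
  have hρint : IntervalIntegrable ρ' volume γ.left γ.right := by
    refine (hinv.mul_continuousOn ?_).add (ContinuousOn.intervalIntegrable ?_)
    · rw [uIcc_of_le hle]
      exact hk.neg.mul (hYc.inner (𝕜 := ℝ) hb)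
    · rw [uIcc_of_le hle]
      exact hv.mul (hYc.inner (𝕜 := ℝ) (hDb.clm_apply hb))
  have hgint : IntervalIntegrable (fun s =>
      (γ.speed s)⁻¹ * inner ℝ (gradStrength B (γ.curve s)) (Y s)) volume γ.left γ.right := by
    refine hinv.mul_continuousOn ?_
    rw [uIcc_of_le hle]
    exact hg.inner (𝕜 := ℝ) hYc
  have hρ : ∫ s in γ.left..γ.right, ρ' s = 0 := by
    rw [intervalIntegral.integral_eq_sub_of_hasDerivAt_of_le hle
      (f := fun s => γ.speed s * inner ℝ (Y s) (unitField B (γ.curve s)))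
      (hv.mul (hYc.inner (𝕜 := ℝ) hb)) (fun s hs => ?_) hρint]
    · simp [speed, γ.strength_left, γ.strength_right]
    · have hs' := Ioo_subset_Icc_self hs
      have hpos := γ.speed_pos hs
      have h1 := (((γ.hasDerivWithinAt_strength hB hs').hasDerivAt
        (Icc_mem_nhds hs.1 hs.2)).const_sub γ.level).const_mul 2
      have h2 := h1.sqrt (ne_of_gt (Real.sqrt_pos.1 hpos))
      have h3 := ((hY s hs').hasDerivAt (Icc_mem_nhds hs.1 hs.2)).inner ℝ
        (γ.hasDerivAt_unitField hB hs)
      refine (h2.mul h3).congr_deriv ?_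
      rw [hB.inner_fderiv_unitField (γ.mem_domain s hs'), add_zero]
      have e : √(2 * (γ.level - ‖B (γ.curve s)‖)) = γ.speed s := rfl
      simp only [ρ', e]
      field_simp
  have hform : EqOn (γ.onTangent (γ.derivForm m μ X σ)) (fun s =>
      (γ.speed s)⁻¹ * inner ℝ (gradStrength B (γ.curve s)) (Y s) + ρ' s)
      (Icc γ.left γ.right) := by
    intro s hs
    have hU := γ.mem_domain s hs
    have hX' := hX s hs
    set x := γ.curve s
    set u := (X (γ.branch m μ σ s)).1
    have hu : u = perp B x (Y s) + inner ℝ u (unitField B x) • unitField B x := by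
      rw [← hX', perp, sub_add_cancel]
    have hκ : inner ℝ (unitField B x) (fderiv ℝ (unitField B) x (unitField B x)) = (0 : ℝ) := by
      rw [real_inner_comm, hB.inner_fderiv_unitField hU]
    -- `X` and `Y` differ by a multiple of `b`, to which the curvature vector is perpendicular.
    have hvol : inner ℝ u (fderiv ℝ (unitField B) x (unitField B x))
        = inner ℝ (Y s) (fderiv ℝ (unitField B) x (unitField B x)) := by
      rw [hu]
      simp only [perp, inner_add_left, inner_sub_left, real_inner_smul_left, hκ, mul_zero,
        sub_zero, add_zero]
    have hform' : γ.onTangent (γ.derivForm m μ X σ) s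
        = inner ℝ (perp B x u) (gradStrength B x) / γ.speed s
            * inner ℝ (unitField B x) (unitField B x)
          - γ.speed s * vol (curl (unitField B) x) u (unitField B x) := rfl
    rw [hform', hX', hB.vol_curl_unitField hU, hvol, hB.inner_unitField_self hU]
    simp only [ρ', perp, inner_sub_left, real_inner_smul_left, strengthDeriv]
    rw [real_inner_comm (Y s) (gradStrength B x)]
    ring
  constructor
  · refine (hgint.add hρint).congr fun s hs => (hform ?_).symm
    rw [uIoc_of_le hle] at hs
    exact Ioc_subset_Icc_self hs
  · have : γ.integral (γ.derivForm m μ X σ) = ∫ s in γ.left..γ.right,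
        ((γ.speed s)⁻¹ * inner ℝ (gradStrength B (γ.curve s)) (Y s) + ρ' s) :=
      intervalIntegral.integral_congr fun s hs => hform (by rwa [uIcc_of_le hle] at hs)
    rw [this, intervalIntegral.integral_add hgint hρint, hρ, add_zero]

end Segment

/-! ### Implicit differentiation and the reduced Hamiltonian -/

/-- Implicit differentiation of a continuous solution of `J (x, H x) = const` at a point where
`J` is differentiable. -/
theorem hasFDerivAt_of_implicit {E : Type*} [NormedAddCommGroup E] [NormedSpace ℝ E]
    {J : E × ℝ → ℝ} {A : E →L[ℝ] ℝ} {T : ℝ} {H : E → ℝ} {x₀ : E} (hT : 0 < T)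
    (hJ : HasFDerivAt J (A.comp (ContinuousLinearMap.fst ℝ E ℝ)
      + T • ContinuousLinearMap.snd ℝ E ℝ) (x₀, H x₀))
    (hH : ContinuousAt H x₀) (hJH : ∀ᶠ x in 𝓝 x₀, J (x, H x) = J (x₀, H x₀)) :
    HasFDerivAt H (-(T⁻¹ • A)) x₀ := by
  have ht : Tendsto (fun x => (x, H x)) (𝓝 x₀) (𝓝 (x₀, H x₀)) :=
    continuousAt_id.prodMk hH
  have hsmall : ∀ ε > 0, ∀ᶠ x in 𝓝 x₀,
      |A (x - x₀) + T * (H x - H x₀)| ≤ ε * (‖x - x₀‖ + |H x - H x₀|) := by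
    intro ε hε
    have h := ht.eventually ((hasFDerivAt_iff_isLittleO.1 hJ).def hε)
    filter_upwards [h, hJH] with x hx hx'
    rw [hx', sub_self, zero_sub, norm_neg] at hx
    have e : ‖(x, H x) - (x₀, H x₀)‖ ≤ ‖x - x₀‖ + |H x - H x₀| :=
      max_le (le_add_of_nonneg_right (abs_nonneg _)) (le_add_of_nonneg_left (norm_nonneg _))
    have := hx.trans (mul_le_mul_of_nonneg_left e hε.le)
    simpa using this
  -- With error factor `T / 2` the term in `|H x - H x₀|` is absorbed on the left, giving a linear a
  -- priori bound on `H`.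
  have hO : ∀ᶠ x in 𝓝 x₀, |H x - H x₀| ≤ (2 * ‖A‖ / T + 1) * ‖x - x₀‖ := by
    filter_upwards [hsmall (T / 2) (by positivity)] with x hx
    have h1 := A.le_opNorm (x - x₀)
    rw [Real.norm_eq_abs] at h1
    have h2 : T * |H x - H x₀| ≤ |A (x - x₀) + T * (H x - H x₀)| + |A (x - x₀)| := by
      rw [← abs_of_pos hT, ← abs_mul, abs_of_pos hT]
      refine le_trans (le_of_eq ?_) (abs_sub _ _)
      congr 1
      ring
    have h3 : T * |H x - H x₀| ≤ (2 * ‖A‖ + T) * ‖x - x₀‖ := by linarith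
    have h4 : (2 * ‖A‖ / T + 1) = (2 * ‖A‖ + T) / T := by field_simp
    rw [h4, div_mul_eq_mul_div, le_div_iff₀ hT]
    linarith
  rw [hasFDerivAt_iff_isLittleO, Asymptotics.isLittleO_iff]
  intro ε hε
  set κ := 2 * ‖A‖ / T + 2
  have hκ : 0 < κ := by positivity
  filter_upwards [hsmall (ε * T / κ) (by positivity), hO] with x hx hxO
  have e : H x - H x₀ - (-(T⁻¹ • A)) (x - x₀) = T⁻¹ * (A (x - x₀) + T * (H x - H x₀)) := by
    simp only [neg_apply, smul_apply, smul_eq_mul]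
    field_simp
    ring
  rw [e, norm_mul, Real.norm_of_nonneg (by positivity), Real.norm_eq_abs, inv_mul_le_iff₀ hT]
  refine hx.trans ?_
  have h1 : ‖x - x₀‖ + |H x - H x₀| ≤ κ * ‖x - x₀‖ := by
    simp only [κ]
    linarith
  calc ε * T / κ * (‖x - x₀‖ + |H x - H x₀|) ≤ ε * T / κ * (κ * ‖x - x₀‖) :=
        mul_le_mul_of_nonneg_left h1 (by positivity)
    _ = T * (ε * ‖x - x₀‖) := by field_simp

/-- If `J` increases strictly with the level to first order at a point, the level sets of `J`
near the point are reached on every nearby line of constant first component. -/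
theorem eventually_exists_level {E : Type*} [NormedAddCommGroup E] [NormedSpace ℝ E]
    {J : E × ℝ → ℝ} {A : E →L[ℝ] ℝ} {T : ℝ} {x₀ : E} {h₀ : ℝ} (hT : 0 < T)
    (hJ : HasFDerivAt J (A.comp (ContinuousLinearMap.fst ℝ E ℝ)
      + T • ContinuousLinearMap.snd ℝ E ℝ) (x₀, h₀))
    (hc : ∀ᶠ x in 𝓝 x₀, Continuous fun h => J (x, h)) {η : ℝ} (hη : 0 < η) :
    ∀ᶠ x in 𝓝 x₀, ∃ h, |h - h₀| < η ∧ J (x, h) = J (x₀, h₀) := by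
  obtain ⟨δ, hδ, hδJ⟩ := Metric.eventually_nhds_iff.1
    ((hasFDerivAt_iff_isLittleO.1 hJ).def (half_pos hT))
  set η' := min η δ / 2
  have hmin : 0 < min η δ := lt_min hη hδ
  have hη' : 0 < η' := by positivity
  have hη'η : η' < η := by
    have := min_le_left η δ
    simp only [η']; linarith
  have hη'δ : η' < δ := by
    have := min_le_right η δ
    simp only [η']; linarith
  have hA : ∀ᶠ x in 𝓝 x₀, ‖A‖ * ‖x - x₀‖ < T * η' / 2 := by
    have h : Continuous fun x => ‖A‖ * ‖x - x₀‖ := by fun_prop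
    have := h.tendsto x₀
    rw [sub_self, norm_zero, mul_zero] at this
    exact this.eventually_lt_const (by positivity)
  filter_upwards [hc, hA, Metric.ball_mem_nhds x₀ hη'] with x hxc hxA hx
  rw [Metric.mem_ball, dist_eq_norm] at hx
  have hAx : |A (x - x₀)| ≤ ‖A‖ * ‖x - x₀‖ := A.le_opNorm _
  -- At `h₀ ± η'` the remainder is at most `T η' / 2` and the `A` term is smaller than that, so the
  -- sign of `± T η'` decides and the two values enclose `J (x₀, h₀)`.
  have key : ∀ k : ℝ, |k| = η' →
      |J (x, h₀ + k) - J (x₀, h₀) - (A (x - x₀) + T * k)| ≤ T / 2 * η' := by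
    intro k hk
    have e : ‖(x, h₀ + k) - (x₀, h₀)‖ ≤ η' := by
      refine max_le hx.le ?_
      simp [hk]
    have := hδJ (y := (x, h₀ + k)) (by
      rw [dist_eq_norm]
      exact e.trans_lt hη'δ)
    refine le_trans (le_of_eq ?_) (this.trans (mul_le_mul_of_nonneg_left e (half_pos hT).le))
    rw [Real.norm_eq_abs]
    simp
  have k1 := (abs_le.1 (key η' (abs_of_pos hη'))).1
  have k2 := (abs_le.1 (key (-η') (by rw [abs_neg, abs_of_pos hη']))).2
  have hAx' := abs_le.1 hAx
  obtain ⟨h, hh, he⟩ := intermediate_value_Icc (a := h₀ + -η') (b := h₀ + η') (by linarith)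
    hxc.continuousOn (show J (x₀, h₀) ∈ Icc _ _ from ⟨by linarith [hAx'.2], by linarith [hAx'.1]⟩)
  refine ⟨h, ?_, he⟩
  rw [abs_lt]
  constructor <;> linarith [hh.1, hh.2]

theorem IsMagneticField.continuousAt_scaledEnergy {U : Set Space} {B : Space → Space}
    (hB : IsMagneticField U B) (m μ : ℝ) {z : Phase} (hz : z.1 ∈ U) :
    ContinuousAt (scaledEnergy m μ B) z := by
  have h : ContinuousAt (fun w : Phase => ‖B w.1‖) z :=
    ContinuousAt.comp (f := Prod.fst) (hB.continuousAt_strength hz) continuousAt_fst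
  exact (((continuousAt_const.mul (continuousAt_snd.pow 2)).div_const 2).add
    (continuousAt_const.mul h)).div_const μ

namespace Segment

variable {U : Set Space} {B : Space → Space}

theorem onTangent_timeForm (hB : IsMagneticField U B) (γ : Segment U B) {s : ℝ}
    (hs : s ∈ Icc γ.left γ.right) : γ.onTangent γ.timeForm s = (γ.speed s)⁻¹ := by
  rw [onTangent, timeForm, hB.inner_unitField_self (γ.mem_domain s hs), mul_one, one_div]

theorem scaledTime_eq (hB : IsMagneticField U B) (γ : Segment U B) :
    γ.scaledTime = ∫ s in γ.left..γ.right, (γ.speed s)⁻¹ :=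
  intervalIntegral.integral_congr fun _ hs =>
    γ.onTangent_timeForm hB (by rwa [uIcc_of_le γ.left_lt_right.le] at hs)

theorem scaledTime_eq_bouncePeriod (hB : IsMagneticField U B) {m μ : ℝ} (hm : 0 < m)
    (hμ : 0 < μ) (γ : Segment U B) :
    γ.scaledTime = √(μ / m) * γ.bouncePeriod m μ / 2 := by
  have hne : √(μ / m) ≠ 0 := (Real.sqrt_pos.2 (by positivity)).ne'
  simp only [bouncePeriod, γ.parallelSpeed_eq hμ hm, mul_inv]
  rw [intervalIntegral.integral_const_mul, γ.scaledTime_eq hB]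
  field_simp

/-- The reduced Hamiltonian is differentiable along a bounce orbit, with derivative given by the
variation of the fieldline. -/
theorem exists_hasFDerivAt_reducedHamiltonian (hB : IsMagneticField U B) {m μ : ℝ} (hμ : 0 < μ)
    (hm : 0 < m) (γ : Segment U B) {s₀ : ℝ} (hs₀ : s₀ ∈ Icc γ.left γ.right) {z : Phase}
    (hz : γ.Carries m μ z) (hzs : γ.curve s₀ = z.1) :
    IntervalIntegrable (fun s => (γ.speed s)⁻¹) volume γ.left γ.right ∧ 0 < γ.scaledTime ∧
    ∃ D : ℝ → Space →L[ℝ] Space, D s₀ = ContinuousLinearMap.id ℝ Space ∧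
      (∀ s ∈ Icc γ.left γ.right, HasDerivWithinAt D
        ((fderiv ℝ (unitField B) (γ.curve s)).comp (D s)) (Icc γ.left γ.right) s) ∧
      DifferentiableAt ℝ (fun w => reducedHamiltonian U B γ.action (wellsAt m μ U B w)) z ∧
      ∀ w, fderiv ℝ (fun w => reducedHamiltonian U B γ.action (wellsAt m μ U B w)) z w
        = 1 / γ.scaledTime * ∫ s in γ.left..γ.right,
          (γ.speed s)⁻¹ * inner ℝ (gradStrength B (γ.curve s)) (D s w.1) := by
  obtain ⟨a, b, C, l₁, r₁, c, α, D, h⟩ := γ.exists_isTurningFamily hB hs₀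
  obtain ⟨hinv, hAint, hJ⟩ := h.hasFDerivAt_familyAction hB
  have hT : 0 < γ.scaledTime := by
    rw [γ.scaledTime_eq hB]
    exact intervalIntegral.intervalIntegral_pos_of_pos_on hinv
      (fun s hs => inv_pos.2 (γ.speed_pos hs)) γ.left_lt_right
  rw [← γ.scaledTime_eq hB] at hJ
  refine ⟨hinv, hT, D, h.variation_start, fun s hs => ?_, ?_⟩
  · have := (h.variation s (h.Icc_subset hs)).mono h.Icc_subset
    rwa [h.eq_curve s hs] at this
  set A := ∫ s in γ.left..γ.right, (γ.speed s)⁻¹ •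
    (innerSL ℝ (gradStrength B (γ.curve s))).comp (D s) with hAdef
  set x₀ := γ.curve s₀ with hx₀
  set S : Space → Set Space := fun x => α x '' Icc l₁ r₁ ∩ criticalSet U B
  have hseg := h.eventually_exists_segment hB hs₀
  obtain ⟨γ₀, hl₀, hw₀, ha₀, hc₀⟩ := hseg.self_of_nhds
  have hx₀γ : x₀ ∈ γ.curve '' Icc γ.left γ.right := mem_image_of_mem _ hs₀
  obtain ⟨hww, haa⟩ := wells_eq_and_action_eq hB hx₀γ
    (hc₀ (γ.strength_le hs₀)) hl₀.symm
  have hJ₀ : familyAction B α a b (x₀, γ.level) = γ.action := by rw [haa, ha₀]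
  set H : Space → ℝ := fun x => reducedHamiltonian U B γ.action (S x)
  have hH₀ : H x₀ = γ.level := by
    simp only [H, S]
    rw [← hw₀, ← hww, γ.reducedHamiltonian_eq hB]
  -- A level close to `γ.level` with the right action exists on each nearby fieldline; uniqueness
  -- identifies it with `H x`, which gives continuity and the implicit equation together.
  have hnear : ∀ η > 0, ∀ᶠ x in 𝓝 x₀, |H x - γ.level| < η ∧
      familyAction B α a b (x, H x) = γ.action := by
    intro η hη
    obtain ⟨V, hV, V', hV', hVV'⟩ := mem_nhds_prod_iff.1 hseg
    obtain ⟨ρ, hρ, hρV⟩ := Metric.mem_nhds_iff.1 hV'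
    filter_upwards [hV, eventually_exists_level hT hJ (h.continuous_familyAction hB)
      (lt_min hη hρ)] with x hxV hx
    obtain ⟨e, he, hJe⟩ := hx
    obtain ⟨γ', hl', hw', ha', -⟩ := hVV' (mk_mem_prod hxV (hρV (by
      rw [Metric.mem_ball, Real.dist_eq]
      exact he.trans_le (min_le_right _ _))))
    have hHe : H x = e := by
      have := γ'.reducedHamiltonian_eq hB
      rw [ha', hJe, hJ₀, hw', hl'] at this
      exact this
    rw [hHe]
    exact ⟨he.trans_le (min_le_left _ _), hJe.trans hJ₀⟩
  have hHcont : ContinuousAt H x₀ := by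
    refine Metric.tendsto_nhds.2 fun η hη => ?_
    rw [hH₀]
    exact (hnear η hη).mono fun x hx => hx.1
  have hHder : HasFDerivAt H (-(γ.scaledTime⁻¹ • -A)) x₀ := by
    refine hasFDerivAt_of_implicit hT (by rwa [hH₀]) hHcont ?_
    rw [hH₀, hJ₀]
    exact (hnear 1 one_pos).mono fun x hx => hx.2
  -- Nearby phase points bounce in the segments just constructed: kinetic energy is nonnegative, so
  -- the strength at `w.1` is at most the level.
  have hwells : ∀ᶠ w in 𝓝 z, wellsAt m μ U B w = S w.1 := by
    have hzU : z.1 ∈ U := by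
      rw [← hzs]
      exact γ.mem_domain s₀ hs₀
    have ht : Tendsto (fun w : Phase => (w.1, scaledEnergy m μ B w)) (𝓝 z)
        (𝓝 (x₀, γ.level)) := by
      rw [hzs, ← hz.2]
      exact continuousAt_fst.prodMk (hB.continuousAt_scaledEnergy m μ hzU)
    filter_upwards [ht.eventually hseg] with w hw
    obtain ⟨γ', hl', hw', -, hc'⟩ := hw
    refine (wellsAt_eq hB ⟨hc' ?_, hl'.symm⟩).trans hw'
    simp only [scaledEnergy]
    rw [le_div_iff₀ hμ]
    nlinarith [sq_nonneg w.2]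
  have hder : HasFDerivAt (fun w => reducedHamiltonian U B γ.action (wellsAt m μ U B w))
      ((-(γ.scaledTime⁻¹ • -A)).comp (ContinuousLinearMap.fst ℝ Space ℝ)) z := by
    have h1 : HasFDerivAt (fun w : Phase => H w.1)
        ((-(γ.scaledTime⁻¹ • -A)).comp (ContinuousLinearMap.fst ℝ Space ℝ)) z :=
      HasFDerivAt.comp (g := H) (f := Prod.fst) z (by rwa [← hzs]) hasFDerivAt_fst
    exact h1.congr_of_eventuallyEq (hwells.mono fun w hw => by simp only [hw, H])
  refine ⟨hder.differentiableAt, fun w => ?_⟩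
  have hAw := ContinuousLinearMap.intervalIntegral_apply hAint w.1
  rw [hder.fderiv]
  simp only [smul_neg, neg_neg, ContinuousLinearMap.comp_apply, ContinuousLinearMap.coe_fst',
    smul_apply, smul_eq_mul, one_div]
  rw [hAdef, hAw]
  simp

end Segment

end GuidingCentre

/-! ### The derivative formula -/

open GuidingCentre
theorem proposition1 (m μ : ℝ) (hm : 0 < m) (hμ : 0 < μ)
    (U : Set Space) (B : Space → Space) (hB : IsMagneticField U B)
    (W : Set Phase) (hW : IsOpen W) (hWU : W ⊆ U ×ˢ Set.univ)
    (X : Phase → Phase) (hX : ContDiffOn ℝ 1 X W)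
    (hcomm : FlowsCommuteOn X (zgcField m μ B) W)
    (hj : ∀ w ∈ W, IsBouncing m μ U B w → fderiv ℝ (actionAt m μ U B) w (X w) = 0)
    (γ : Segment U B) (hγ : ∀ w, γ.Carries m μ w → w ∈ W)
    (z : Phase) (hz : γ.Carries m μ z) :
    reducedHamiltonian U B γ.action γ.wells = γ.level ∧
    wellsAt m μ U B z = γ.wells ∧
    DifferentiableAt ℝ
      (fun w => reducedHamiltonian U B γ.action (wellsAt m μ U B w)) z ∧
    IntervalIntegrable (γ.onTangent γ.timeForm) MeasureTheory.volume γ.left γ.right ∧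
    0 < γ.scaledTime ∧
    γ.scaledTime = √(μ / m) * γ.bouncePeriod m μ / 2 ∧
    ∀ σ : ℝ, σ = 1 ∨ σ = -1 →
      IntervalIntegrable (γ.onTangent (γ.derivForm m μ X σ)) MeasureTheory.volume
        γ.left γ.right ∧
      fderiv ℝ (fun w => reducedHamiltonian U B γ.action (wellsAt m μ U B w)) z (X z)
        = 1 / γ.scaledTime * γ.integral (γ.derivForm m μ X σ) := by
  obtain ⟨σ₀, s₀, hσ₀, hs₀, hbr⟩ := γ.exists_branch_eq hm hμ hz
  obtain ⟨hinv, hT, D, hD₀, hD, hdiff, hder⟩ :=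
    γ.exists_hasFDerivAt_reducedHamiltonian hB hμ hm hs₀ hz (congrArg Prod.fst hbr)
  -- The variation of fieldlines that starts at `z` with the spatial part of `X z`.
  have hY : ∀ s ∈ Icc γ.left γ.right, HasDerivWithinAt (fun s => D s (X z).1)
      (fderiv ℝ (unitField B) (γ.curve s) (D s (X z).1)) (Icc γ.left γ.right) s := fun s hs => by
    simpa using (hD s hs).clm_apply (hasDerivWithinAt_const s (Icc γ.left γ.right) (X z).1)
  refine ⟨γ.reducedHamiltonian_eq hB, Segment.wellsAt_eq hB hz, hdiff, ?_, hT,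
    γ.scaledTime_eq_bouncePeriod hB hm hμ, fun σ hσ => ?_⟩
  · refine hinv.congr fun s hs => (γ.onTangent_timeForm hB ?_).symm
    rw [uIoc_of_le γ.left_lt_right.le] at hs
    exact Ioc_subset_Icc_self hs
  · obtain ⟨hint, heq⟩ := γ.integral_variation_eq hB hinv hY (m := m) (μ := μ) (σ := σ) (X := X)
      fun s hs => γ.perp_eq_of_commute hm hμ hB hW hWU hX hcomm hγ hY hσ₀ hs₀
        (by simp [hD₀, hbr]) hσ hs
    exact ⟨hint, by rw [hder, heq]⟩
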